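/- Let $\omega=\mathbb C^{\mathbb N}$ be the space of complex sequences $(x_n)_{n\ge 0}$ and let $e_n$ be its canonical vectors. A \emph{Fréchet sequence algebra for the coordinatewise product} is a subspace $X\subset\omega$, stable under the coordinatewise product, with a complete topology induced by a non-decreasing separating sequence of seminorms $(\|\cdot\|_q)_{q\ge1}$ such that the inclusion $X\hookrightarrow\omega$ is continuous and $\|x\cdot y\|_q\le\|x\|_q\|y\|_q$ for all $x,y\in X$ and $q\ge1$. We write $\|x\|=\sum_{q\ge1}2^{-q}\min(1,\|x\|_q)$ for the associated F-norm. A weighted shift $B_w$ on $X$ is a continuous operator $B_w:X\to X$ of the form $B_w(x_0,x_1,x_2,\dots)=(w_1x_1,w_2x_2,\dots)$, where $w_n>0$. The space $X^d$ carries the product topology and the coordinatewise product. A vector $u$ is hypercyclic for an operator $T$ if $\{T^nu:n\ge1\}$ is dense; it is a common hypercyclic vector for a family of operators if it is hypercyclic for each of its members; and the family admits a \emph{common hypercyclic algebra} if there is a non-zero subalgebra all of whose non-zero elements are common hypercyclic vectors for the family. \textbf{Theorem.} Let $X$ be a Fréchet sequence algebra for the coordinatewise product which has a continuous norm and admits $(e_n)_{n\ge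 0}$ as an unconditional basis. Let $I\subset\mathbb R$ be a nonempty interval, let $d\ge1$ and let $\Lambda\subset I^d$ be $\sigma$-compact. Let $(B_{w(a)})_{a\in I}$ be a family of weighted shifts on $X$ such that, for every $n\ge 1$, the map $a\in I\mapsto w_n(a)$ is non-decreasing, and such that $\inf_{n\ge1,a\in I}w_n(a)>0$. Assume that there exist a non-decreasing function $F:\mathbb N\to[0,+\infty)$ and constants $c,C>0$ such that, for all $n\ge1$ and all $a,b\in I$, writing $f_n(a)=\sum_{k=1}^n\log w_k(a)$, $$cF(n)|a-b|\le|f_n(a)-f_n(b)|\le CF(n)|a-b|\qquad\text{and}\qquad \frac{w_n(a)}{w_n(b)}\ge c.$$ Then the following assertions are equivalent. (a) $(B_{w(\lambda(1))}\times\cdots\times B_{w(\lambda(d))})_{\lambda\in\Lambda}$ admits a common hypercyclic algebra in $X^d$. (b) For all $m\ge1$ there exists $u\in X^d$ such that $u^m$ is a common hypercyclic vector for $(B_{w(\lambda(1))}\times\cdots\times B_{w(\lambda(d))})_{\lambda\in\Lambda}$. (c) For all $m\ge1$, $\tau>0$, $N\ge1$, $\varepsilon>0$ and every compact $K\subset\Lambda$,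 there exist $q\ge 0$, integers $n_1,\dots,n_q$ with $n_1\ge N$ and $n_{k+1}\ge n_k+N$ for $1\le k<q$, and $\lambda_1,\dots,\lambda_q\in I^d$ such that (i) $K\subset\bigcup_{k=1}^q\prod_{l=1}^d\left[\lambda_k(l)-\frac{\tau}{F(n_k)},\lambda_k(l)\right]$, where $\left[t-\frac{\tau}{0},t\right]$ means $(-\infty,t]$; (ii) for all $i=1,\dots,d$, $$\left\|\sum_{k=1}^q\frac{1}{\big[w_1(\lambda_k(i))\cdots w_{n_k}(\lambda_k(i))\big]^{1/m}}\,e_{n_k}\right\|<\varepsilon;$$ (iii) for all $k=1,\dots,q$, all $i=1,\dots,d$ and all $l=0,\dots,N$, $$\left\|\sum_{j=k+1}^q\frac{w_{n_j-n_k+l+1}(\lambda_k(i))\cdots w_{n_j+l}(\lambda_k(i))}{w_{l+1}(\lambda_j(i))\cdots w_{n_j+l}(\lambda_j(i))}\,e_{n_j-n_k+l}\right\|<\varepsilon.$$ -/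

import Mathlib

open Set Filter Topology

namespace CommonHypercyclic

/-- The type `X`, seen through the coordinate map `coord` as a space of complex sequences indexed
by `0, 1, 2, …`, is a Fréchet sequence algebra for the coordinatewise product: `coord` is an
injective and continuous homomorphism into the algebra of all sequences (with coordinatewise
operations and the topology of pointwise convergence), and the complete topology of `X` is induced
by the non-decreasing separating sequence of submultiplicative seminorms `p 0 ≤ p 1 ≤ …`. -/
structure IsFrechetSequenceAlgebra {X : Type*} [NonUnitalCommRing X] [Module ℂ X]
    [UniformSpace X] [IsUniformAddGroup X]
    (coord : X →ₙₐ[ℂ] (ℕ → ℂ)) (p : ℕ → Seminorm ℂ X) : Prop where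
  coord_injective : Function.Injective coord
  coord_continuous : Continuous coord
  seminorm_mono : Monotone p
  seminorm_separating : ∀ x : X, (∀ q, p q x = 0) → x = 0
  seminorm_mul_le : ∀ (q : ℕ) (x y : X), p q (x * y) ≤ p q x * p q y
  withSeminorms : WithSeminorms p
  complete : CompleteSpace X

/-- The F-norm `∑_q 2^{-(q+1)} min (1, p_q x)` attached to a sequence of seminorms. -/
noncomputable def fNorm {X : Type*} [AddCommGroup X] [Module ℂ X]
    (p : ℕ → Seminorm ℂ X) (x : X) : ℝ :=
  ∑' q : ℕ, (1 / 2 : ℝ) ^ (q + 1) * min 1 (p q x)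

/-- There is a continuous norm on `X`. -/
def HasContinuousNorm (X : Type*) [AddCommGroup X] [Module ℂ X] [TopologicalSpace X] : Prop :=
  ∃ r : Seminorm ℂ X, Continuous r ∧ ∀ x : X, r x = 0 → x = 0

/-- `e` is an unconditional basis: every vector has an expansion along `e` that converges
unconditionally, and that is its only expansion with convergent partial sums. -/
def IsUnconditionalBasis {X : Type*} [AddCommGroup X] [Module ℂ X] [TopologicalSpace X]
    (e : ℕ → X) : Prop :=
  ∀ x : X, ∃ a : ℕ → ℂ, HasSum (fun n => a n • e n) x ∧
    ∀ b : ℕ → ℂ,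
      Tendsto (fun N => ∑ n ∈ Finset.range N, b n • e n) atTop (𝓝 x) → b = a

/-- `B` is the weighted backward shift with weights `w 1, w 2, …`, that is
`B (x₀, x₁, x₂, …) = (w₁ x₁, w₂ x₂, …)`. The value `w 0` plays no role. -/
def IsWeightedShift {X : Type*} [NonUnitalCommRing X] [Module ℂ X] [TopologicalSpace X]
    (coord : X →ₙₐ[ℂ] (ℕ → ℂ)) (w : ℕ → ℝ) (B : X →L[ℂ] X) : Prop :=
  ∀ (x : X) (n : ℕ), coord (B x) n = (w (n + 1) : ℂ) * coord x (n + 1)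

/-- The operator `B_{λ(1)} × ⋯ × B_{λ(d)}` on `X^d`. -/
def prodOp {X : Type*} [AddCommGroup X] [Module ℂ X] [TopologicalSpace X] {d : ℕ}
    (B : ℝ → X →L[ℂ] X) (lam : Fin d → ℝ) (v : Fin d → X) : Fin d → X :=
  fun i => B (lam i) (v i)

/-- The orbit `{T^n y : n ≥ 1}` is dense. -/
def IsHypercyclicVector {Y : Type*} [TopologicalSpace Y] (T : Y → Y) (y : Y) : Prop :=
  Dense {z : Y | ∃ n : ℕ, 1 ≤ n ∧ z = T^[n] y}

/-- `y` is hypercyclic for every member of the family `(T lam)` with `lam ∈ Λ`. -/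
def IsCommonHypercyclicVector {ι Y : Type*} [TopologicalSpace Y] (T : ι → Y → Y) (Λ : Set ι)
    (y : Y) : Prop :=
  ∀ lam ∈ Λ, IsHypercyclicVector (T lam) y

/-- The family `(T lam)`, `lam ∈ Λ`, has a common hypercyclic algebra: a non-zero subalgebra, all
of whose non-zero elements are common hypercyclic vectors. -/
def HasCommonHypercyclicAlgebra {ι Y : Type*} [NonUnitalCommRing Y] [Module ℂ Y]
    [TopologicalSpace Y] (T : ι → Y → Y) (Λ : Set ι) : Prop :=
  ∃ A : NonUnitalSubalgebra ℂ Y, (∃ y ∈ A, y ≠ 0) ∧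
    ∀ y ∈ A, y ≠ 0 → IsCommonHypercyclicVector T Λ y

/-- The power `u ^ m` for `m ≥ 1` in a ring that need not have a unit (the value at `m = 0` is
irrelevant). -/
def algPow {Y : Type*} [Mul Y] (u : Y) : ℕ → Y
  | 0 => u
  | 1 => u
  | m + 2 => algPow u (m + 1) * u

/-- The product `w_i(a) w_{i+1}(a) ⋯ w_j(a)`. -/
noncomputable def weightProd (w : ℕ → ℝ → ℝ) (a : ℝ) (i j : ℕ) : ℝ :=
  ∏ s ∈ Finset.Icc i j, w s a

/-- `f_n(a) = ∑_{k=1}^n log w_k(a)`. -/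
noncomputable def logSum (w : ℕ → ℝ → ℝ) (n : ℕ) (a : ℝ) : ℝ :=
  ∑ k ∈ Finset.Icc 1 n, Real.log (w k a)

/-- The interval `[t - τ/φ, t]`, with the convention `τ/0 = +∞`. -/
def tagInterval (τ φ t : ℝ) : Set ℝ := {x | x ≤ t ∧ φ * (t - x) ≤ τ}

theorem tagInterval_of_pos {τ φ : ℝ} (t : ℝ) (hφ : 0 < φ) :
    tagInterval τ φ t = Icc (t - τ / φ) t := by
  ext x
  simp only [tagInterval, mem_ofPred_eq, mem_Icc, and_comm (a := x ≤ t)]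
  rw [mul_comm, ← le_div_iff₀ hφ, sub_le_comm]

theorem tagInterval_zero {τ : ℝ} (t : ℝ) (hτ : 0 < τ) : tagInterval τ 0 t = Iic t := by
  ext x
  simp [tagInterval, hτ.le]

end CommonHypercyclic

/-!
Hypercyclic algebras for products of backward shifts and coverings of the parameter set.

*Solid seminorms.* Since `e` is an unconditional basis, the finite-rank multipliers with
coefficients in the unit disc are pointwise bounded, hence equicontinuous by the uniform boundedness
principle. Taking suprema over them gives seminorms `R q` which define the topology and depend
monotonically on the moduli of the coordinates (`IsFrechetSequenceAlgebra.exists_solidSystem`). The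
continuous norm and the idempotence of `e n` give `R q (e n) ≥ 1` for all `n`, so that `R q` dominates
the coordinates uniformly. All estimates are then comparisons of coordinates. In particular the
bound below on quotients of weights makes `(a, x) ↦ B a x` jointly continuous.

*Necessity.* If `v = u ^ m` is a common hypercyclic vector, let `E n` be the set of `lam ∈ K` such that
the `n`-th iterate of `v` under the operator with parameter `lam` is close to `2 (e_0 + ⋯ + e_N)`. The
sets `E n` are open and cover `K`, so finitely many suffice. For a fixed `n` the value of the
coordinate `n` of `v` pins the product of the first `n` weights up to a factor near `1`, so that `E n`
lies in one box, whose upper corner is the coordinatewise supremum of `E n`. Two indices at distance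
at most `N` cannot both occur (`not_near_target_of_near_target`). The smallness of the first family of
sums comes from the tail of `u`, that of the second from the coordinates at which
`2 (e_0 + ⋯ + e_N)` vanishes.

*Sufficiency.* For a finitely supported target `v`, the vector `u` carries, on the block ending at
each `n_k`, `m`-th roots of the coordinates of `v` divided by products of weights
(`blockSum`, `exists_perturbation`). Ending the blocks at `n_k`, instead of starting them there, lets
continuity of a shift turn the first smallness condition into smallness of the whole perturbation,
and only involves weights with indices at most `n_k` there, so that their products vary by a factor
near `1` on the `k`-th box. Monotonicity of the weights and the second smallness condition control the
blocks after the `k`-th one. As the coordinates of the perturbation are small, powers of `u` higher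
than `m` are negligible along the same iterate. By the Baire category theorem, a generic `u` is such
that every polynomial in `u` whose lowest-order term is `u ^ m` has a dense orbit, for every `m ≥ 1`
and every parameter in `Λ`; the polynomials in `u` without constant term form the algebra.
-/

namespace CommonHypercyclic

/-! ### Solid seminorms -/

section Seminorm

variable {E ι : Type*} [AddCommGroup E] [Module ℂ E]

/-- Coefficients in `[0, 1]` are convex combinations of coefficients in `{0, 1}`. -/
theorem seminorm_add_sum_smul_le_of_mem_Icc [DecidableEq ι] (p : Seminorm ℂ E) (y : ι → E)
    (a : ι → ℝ) (ha : ∀ n, a n ∈ Icc (0 : ℝ) 1) {M : ℝ} (t : Finset ι) :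
    ∀ z : E, (∀ s ⊆ t, p (z + ∑ n ∈ s, y n) ≤ M) → p (z + ∑ n ∈ t, (a n : ℂ) • y n) ≤ M := by
  induction t using Finset.induction_on with
  | empty => intro z h; simpa using h ∅ le_rfl
  | insert n t hn ih =>
    intro z h
    rw [Finset.sum_insert hn, ← add_assoc]
    refine ih _ fun s hs => ?_
    have h0 := h s (hs.trans (Finset.subset_insert n t))
    have h1 := h (insert n s) (Finset.insert_subset_insert n hs)
    rw [Finset.sum_insert (fun h => hn (hs h))] at h1
    have hsplit : z + (a n : ℂ) • y n + ∑ n ∈ s, y n =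
        ((1 - a n : ℝ) : ℂ) • (z + ∑ n ∈ s, y n) +
          ((a n : ℝ) : ℂ) • (z + (y n + ∑ n ∈ s, y n)) := by
      push_cast
      simp only [smul_add, sub_smul, one_smul]
      abel
    rw [hsplit]
    refine (map_add_le_add p _ _).trans ?_
    rw [map_smul_eq_mul, map_smul_eq_mul, Complex.norm_real, Complex.norm_real,
      Real.norm_of_nonneg (ha n).1, Real.norm_of_nonneg (sub_nonneg.2 (ha n).2)]
    nlinarith [(ha n).1, (ha n).2]

theorem seminorm_sum_smul_le_of_mem_Icc [DecidableEq ι] (p : Seminorm ℂ E) (y : ι → E)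
    (a : ι → ℝ) (ha : ∀ n, a n ∈ Icc (0 : ℝ) 1) {M : ℝ} (t : Finset ι)
    (h : ∀ s ⊆ t, p (∑ n ∈ s, y n) ≤ M) : p (∑ n ∈ t, (a n : ℂ) • y n) ≤ M := by
  simpa using seminorm_add_sum_smul_le_of_mem_Icc p y a ha t 0 (by simpa using h)

theorem seminorm_lt_mem_nhds [TopologicalSpace E] {r : Seminorm ℂ E} (hr : Continuous r) {η : ℝ}
    (hη : 0 < η) : {x : E | r x < η} ∈ 𝓝 (0 : E) := by
  refine (isOpen_lt hr continuous_const).mem_nhds ?_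
  simpa using hη

theorem seminorm_sum_smul_le [DecidableEq ι] (p : Seminorm ℂ E) (y : ι → E)
    (a : ι → ℂ) (ha : ∀ n, ‖a n‖ ≤ 1) {M : ℝ} (t : Finset ι)
    (h : ∀ s ⊆ t, p (∑ n ∈ s, y n) ≤ M) : p (∑ n ∈ t, a n • y n) ≤ 4 * M := by
  have key : ∀ f : ι → ℝ, (∀ n, |f n| ≤ 1) → p (∑ n ∈ t, (f n : ℂ) • y n) ≤ 2 * M := by
    intro f hf
    have hsplit : ∑ n ∈ t, (f n : ℂ) • y n =
        ∑ n ∈ t, ((max (f n) 0 : ℝ) : ℂ) • y n - ∑ n ∈ t, ((max (-f n) 0 : ℝ) : ℂ) • y n := by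
      rw [← Finset.sum_sub_distrib]
      refine Finset.sum_congr rfl fun n _ => ?_
      rw [← sub_smul, ← Complex.ofReal_sub, max_zero_sub_max_neg_zero_eq_self]
    rw [hsplit, two_mul]
    refine (map_sub_le_add p _ _).trans (add_le_add ?_ ?_)
    · exact seminorm_sum_smul_le_of_mem_Icc p y _
        (fun n => ⟨le_max_right _ _, max_le (abs_le.1 (hf n)).2 zero_le_one⟩) t h
    · exact seminorm_sum_smul_le_of_mem_Icc p y _
        (fun n => ⟨le_max_right _ _, max_le (by linarith [(abs_le.1 (hf n)).1]) zero_le_one⟩) t h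
  have hsplit : ∑ n ∈ t, a n • y n =
      ∑ n ∈ t, ((a n).re : ℂ) • y n + Complex.I • ∑ n ∈ t, ((a n).im : ℂ) • y n := by
    rw [Finset.smul_sum, ← Finset.sum_add_distrib]
    refine Finset.sum_congr rfl fun n _ => ?_
    rw [smul_smul, ← add_smul, mul_comm, Complex.re_add_im]
  rw [hsplit]
  refine (map_add_le_add p _ _).trans ?_
  rw [map_smul_eq_mul, Complex.norm_I, one_mul]
  have h1 := key _ fun n => (Complex.abs_re_le_norm (a n)).trans (ha n)
  have h2 := key _ fun n => (Complex.abs_im_le_norm (a n)).trans (ha n)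
  linarith

end Seminorm

variable {X : Type*} [NonUnitalCommRing X] [Module ℂ X]

/-- The finite-rank multiplier `x ↦ ∑_{n ∈ t} a_n x_n e_n`. -/
noncomputable def multiplier (coord : X →ₙₐ[ℂ] (ℕ → ℂ)) (e : ℕ → X) (t : Finset ℕ) (a : ℕ → ℂ) :
    X →ₗ[ℂ] X where
  toFun x := ∑ n ∈ t, a n • coord x n • e n
  map_add' x y := by simp [add_smul, smul_add, Finset.sum_add_distrib]
  map_smul' c x := by
    simp only [map_smul, Pi.smul_apply, RingHom.id_apply, Finset.smul_sum, smul_smul, smul_eq_mul]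
    exact Finset.sum_congr rfl fun n _ => by ring_nf

/-- A sequence of seminorms `R q` that defines the topology of the sequence space `X` with
basis `e`, each of which is *solid* (it is monotone in the moduli of the coordinates) and dominates
the moduli of the coordinates. -/
structure IsSolidSystem [TopologicalSpace X] (coord : X →ₙₐ[ℂ] (ℕ → ℂ)) (e : ℕ → X)
    (R : ℕ → Seminorm ℂ X) : Prop where
  coord_injective : Function.Injective coord
  coord_e : ∀ n, coord (e n) = Pi.single n 1
  hasSum_coord : ∀ x : X, HasSum (fun n => coord x n • e n) x
  continuous : ∀ q, Continuous (R q)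
  exists_lt_imp_mem : ∀ U ∈ 𝓝 (0 : X), ∃ q, ∃ η > 0, ∀ x, R q x < η → x ∈ U
  solid : ∀ q x y, (∀ n, ‖coord x n‖ ≤ ‖coord y n‖) → R q x ≤ R q y
  norm_coord_le : ∀ q x n, ‖coord x n‖ ≤ R q x

section Expansion

variable {coord : X →ₙₐ[ℂ] (ℕ → ℂ)} {e : ℕ → X}

theorem coord_sum_smul (he : ∀ n, coord (e n) = Pi.single n 1) (t : Finset ℕ) (a : ℕ → ℂ)
    (n : ℕ) : coord (∑ k ∈ t, a k • e k) n = if n ∈ t then a n else 0 := by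
  simp [map_sum, he, Finset.sum_apply, Pi.single_apply]

/-- Since the coordinates are continuous, the expansion along the basis `e` is given by them. -/
theorem IsUnconditionalBasis.hasSum_coord [TopologicalSpace X] (hcont : Continuous coord)
    (he : ∀ n, coord (e n) = Pi.single n 1) (hbasis : IsUnconditionalBasis e) (x : X) :
    HasSum (fun n => coord x n • e n) x := by
  obtain ⟨a, ha, -⟩ := hbasis x
  suffices hx : ∀ n, coord x n = a n by simpa only [hx] using ha
  intro n
  have hmap := ha.map (Pi.evalAddMonoidHom (fun _ : ℕ => ℂ) n |>.comp
    (coord : X →+ (ℕ → ℂ))) ((continuous_apply n).comp hcont)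
  refine hmap.unique ?_
  convert hasSum_ite_eq n (a n) using 2 with k
  by_cases h : k = n
  · simp [he, h]
  · simp [he, h, Ne.symm h]

end Expansion

section Exists

variable [UniformSpace X] [IsUniformAddGroup X] {coord : X →ₙₐ[ℂ] (ℕ → ℂ)} {p : ℕ → Seminorm ℂ X}
  {e : ℕ → X}

theorem IsFrechetSequenceAlgebra.continuousSMul (hX : IsFrechetSequenceAlgebra coord p) :
    ContinuousSMul ℂ X := hX.withSeminorms.continuousSMul

theorem IsFrechetSequenceAlgebra.uniformity_isCountablyGenerated
    (hX : IsFrechetSequenceAlgebra coord p) : (uniformity X).IsCountablyGenerated := by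
  have := hX.withSeminorms.firstCountableTopology
  exact IsUniformAddGroup.uniformity_countably_generated

theorem IsFrechetSequenceAlgebra.t2Space (hX : IsFrechetSequenceAlgebra coord p) : T2Space X :=
  T2Space.of_injective_continuous hX.coord_injective hX.coord_continuous

theorem IsFrechetSequenceAlgebra.exists_seminorm_lt_imp_mem
    (hX : IsFrechetSequenceAlgebra coord p) {U : Set X} (hU : U ∈ 𝓝 (0 : X)) :
    ∃ q, ∃ η > 0, ∀ x, p q x < η → x ∈ U := by
  obtain ⟨⟨s, η⟩, hη, hs⟩ := hX.withSeminorms.hasBasis_zero_ball.mem_iff.1 hU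
  refine ⟨s.sup id, η, hη, fun x hx => hs ?_⟩
  rw [Seminorm.mem_ball_zero]
  refine lt_of_le_of_lt ?_ hx
  exact (Finset.sup_le fun i hi => hX.seminorm_mono (Finset.le_sup (f := id) hi) :
    s.sup p ≤ p (s.sup id)) x

/-- As the basis vectors are idempotent, each continuous seminorm not vanishing on `e n` is at least
`1` there; a continuous norm makes this uniform in `n`. -/
theorem IsFrechetSequenceAlgebra.exists_one_le_seminorm (hX : IsFrechetSequenceAlgebra coord p)
    (hnorm : HasContinuousNorm X) (he : ∀ n, coord (e n) = Pi.single n 1) :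
    ∃ q₀, ∀ q, q₀ ≤ q → ∀ n, 1 ≤ p q (e n) := by
  obtain ⟨r, hr, hr0⟩ := hnorm
  have hU : {x : X | r x < 1} ∈ 𝓝 (0 : X) :=
    seminorm_lt_mem_nhds hr one_pos
  obtain ⟨q₀, η, hη, h⟩ := hX.exists_seminorm_lt_imp_mem hU
  refine ⟨q₀, fun q hq n => ?_⟩
  have hen : e n ≠ 0 := fun h0 => by
    have := congrFun (he n) n
    simp [h0] at this
  have hpos : p q (e n) ≠ 0 := by
    intro h0
    have h0' : p q₀ (e n) = 0 :=
      le_antisymm ((hX.seminorm_mono hq (e n)).trans h0.le) (apply_nonneg _ _)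
    have hrn : 0 < r (e n) := lt_of_le_of_ne (apply_nonneg _ _) fun h => hen (hr0 _ h.symm)
    have := h (((r (e n))⁻¹ : ℂ) • e n) (by rw [map_smul_eq_mul, h0', mul_zero]; exact hη)
    simp only [mem_ofPred_eq, map_smul_eq_mul, norm_inv, Complex.norm_real,
      Real.norm_of_nonneg hrn.le, inv_mul_cancel₀ hrn.ne', lt_irrefl] at this
  have hidem : e n * e n = e n := hX.coord_injective (by
    rw [map_mul, he, ← Pi.single_mul, one_mul])
  have := hX.seminorm_mul_le q (e n) (e n)
  rw [hidem] at this
  have hpos' := lt_of_le_of_ne (apply_nonneg (p q) (e n)) (Ne.symm hpos)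
  nlinarith

theorem IsFrechetSequenceAlgebra.bddAbove_multiplier (hX : IsFrechetSequenceAlgebra coord p)
    (hsum : ∀ x : X, HasSum (fun n => coord x n • e n) x) (q : ℕ) :
    BddAbove (range fun i : Finset ℕ × {a : ℕ → ℂ // ∀ n, ‖a n‖ ≤ 1} =>
      (p q).comp (multiplier coord e i.1 i.2)) := by
  classical
  rw [Seminorm.bddAbove_range_iff]
  intro x
  have hU : {x : X | p q x < 1} ∈ 𝓝 (0 : X) :=
    seminorm_lt_mem_nhds (hX.withSeminorms.continuous_seminorm q) one_pos
  obtain ⟨s₀, hs₀⟩ := (hsum x).summable.vanishing hU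
  refine ⟨4 * (∑ n ∈ s₀, p q (coord x n • e n) + 1), ?_⟩
  rintro _ ⟨⟨t, a, ha⟩, rfl⟩
  refine seminorm_sum_smul_le (p q) (fun n => coord x n • e n) a ha t fun s _ => ?_
  rw [← Finset.sum_inter_add_sum_sdiff s s₀]
  refine (map_add_le_add _ _ _).trans (add_le_add ?_ (hs₀ _ Finset.sdiff_disjoint).le)
  refine (Finset.le_sum_of_subadditive (p q) (map_zero _).le (map_add_le_add _) _ _).trans ?_
  exact Finset.sum_le_sum_of_subset_of_nonneg Finset.inter_subset_right fun _ _ _ => apply_nonneg _ _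

/-- By the uniform boundedness principle, the suprema of `p q` over all multipliers with
coefficients in the unit disc are continuous; they form a solid system of seminorms. -/
theorem IsFrechetSequenceAlgebra.exists_solidSystem (hX : IsFrechetSequenceAlgebra coord p)
    (hnorm : HasContinuousNorm X) (he : ∀ n, coord (e n) = Pi.single n 1)
    (hbasis : IsUnconditionalBasis e) :
    ∃ R : ℕ → Seminorm ℂ X, IsSolidSystem coord e R := by
  have hsum := hbasis.hasSum_coord hX.coord_continuous he
  obtain ⟨q₀, hq₀⟩ := hX.exists_one_le_seminorm hnorm he
  have := hX.continuousSMul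
  have := hX.uniformity_isCountablyGenerated
  have := hX.complete
  have hbdd := hX.bddAbove_multiplier hsum
  let R : ℕ → Seminorm ℂ X := fun q => ⨆ i : Finset ℕ × {a : ℕ → ℂ // ∀ n, ‖a n‖ ≤ 1},
    (p (q + q₀)).comp (multiplier coord e i.1 i.2)
  have hRapp : ∀ q x, R q x = ⨆ i : Finset ℕ × {a : ℕ → ℂ // ∀ n, ‖a n‖ ≤ 1},
      p (q + q₀) (multiplier coord e i.1 i.2 x) := fun q x => Seminorm.iSup_apply (hbdd _)
  have hle : ∀ q x (t : Finset ℕ) (a : ℕ → ℂ), (∀ n, ‖a n‖ ≤ 1) →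
      p (q + q₀) (multiplier coord e t a x) ≤ R q x := by
    intro q x t a ha
    rw [hRapp]
    exact le_ciSup (Seminorm.bddAbove_range_iff.1 (hbdd (q + q₀)) x) (t, ⟨a, ha⟩)
  have hRle : ∀ q x M, (∀ (t : Finset ℕ) (a : ℕ → ℂ), (∀ n, ‖a n‖ ≤ 1) →
      p (q + q₀) (multiplier coord e t a x) ≤ M) → R q x ≤ M := by
    intro q x M h
    rw [hRapp]
    have : Nonempty (Finset ℕ × {a : ℕ → ℂ // ∀ n, ‖a n‖ ≤ 1}) := ⟨(∅, ⟨0, by simp⟩)⟩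
    exact ciSup_le fun i => h _ _ i.2.2
  have hpR : ∀ q x, p (q + q₀) x ≤ R q x := by
    intro q x
    refine le_of_tendsto (((hX.withSeminorms.continuous_seminorm (q + q₀)).tendsto x).comp
      (hsum x)) (Eventually.of_forall fun t => ?_)
    simpa [multiplier] using hle q x t 1 (by simp)
  refine ⟨R, hX.coord_injective, he, hsum, fun q => ?_, fun U hU => ?_,
    fun q x y hxy => ?_, fun q x n => ?_⟩
  · simp only [R, Seminorm.coe_iSup_eq (hbdd _)]
    refine Seminorm.continuous_iSup _ (fun i => ?_) (hbdd _)
    have hcoord : ∀ n, Continuous fun x : X => coord x n :=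
      fun n => (continuous_apply n).comp hX.coord_continuous
    have hmult : Continuous (multiplier coord e i.1 (i.2 : ℕ → ℂ)) := by
      simp only [multiplier, LinearMap.coe_mk, AddHom.coe_mk]
      exact continuous_finsetSum _ fun n _ => ((hcoord n).smul continuous_const).const_smul _
    exact (hX.withSeminorms.continuous_seminorm _).comp hmult
  · obtain ⟨q, η, hη, h⟩ := hX.exists_seminorm_lt_imp_mem hU
    exact ⟨q, η, hη, fun x hx => h x
      (((hX.seminorm_mono (Nat.le_add_right q q₀) x).trans (hpR q x)).trans_lt hx)⟩
  · refine hRle _ _ _ fun t a ha => ?_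
    have hmul : multiplier coord e t a x =
        multiplier coord e t (fun n => a n * (coord x n / coord y n)) y := by
      simp only [multiplier, LinearMap.coe_mk, AddHom.coe_mk, smul_smul]
      refine Finset.sum_congr rfl fun n _ => ?_
      rw [mul_assoc, div_mul_cancel_of_imp]
      intro h0
      simpa [h0] using hxy n
    rw [hmul]
    refine hle _ _ _ _ fun n => ?_
    rw [norm_mul, norm_div]
    exact mul_le_one₀ (ha n) (by positivity) (div_le_one_of_le₀ (hxy n) (norm_nonneg _))
  · have h1 := hle q x {n} 1 (by simp)
    simp only [multiplier, LinearMap.coe_mk, AddHom.coe_mk, Finset.sum_singleton, Pi.one_apply,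
      one_smul, map_smul_eq_mul] at h1
    exact (le_mul_of_one_le_right (norm_nonneg _) (hq₀ _ (Nat.le_add_left _ _) n)).trans h1

end Exists

/-! ### The F-norm and neighbourhoods of zero -/

section FNorm

variable {X : Type*} [NonUnitalCommRing X] [Module ℂ X]

theorem summable_half_pow_succ : Summable fun q : ℕ => (1 / 2 : ℝ) ^ (q + 1) :=
  (summable_nat_add_iff 1).2 summable_geometric_two

theorem fNorm_term_nonneg (p : ℕ → Seminorm ℂ X) (x : X) (q : ℕ) :
    0 ≤ (1 / 2 : ℝ) ^ (q + 1) * min 1 (p q x) := by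
  have := apply_nonneg (p q) x
  positivity

theorem fNorm_term_le (p : ℕ → Seminorm ℂ X) (x : X) (q : ℕ) :
    (1 / 2 : ℝ) ^ (q + 1) * min 1 (p q x) ≤ (1 / 2 : ℝ) ^ (q + 1) :=
  mul_le_of_le_one_right (by positivity) (min_le_left _ _)

variable [UniformSpace X] [IsUniformAddGroup X] {coord : X →ₙₐ[ℂ] (ℕ → ℂ)} {p : ℕ → Seminorm ℂ X}

theorem IsFrechetSequenceAlgebra.fNorm_lt_mem_nhds (hX : IsFrechetSequenceAlgebra coord p) {ε : ℝ}
    (hε : 0 < ε) : {x : X | fNorm p x < ε} ∈ 𝓝 (0 : X) := by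
  have hcont : Continuous (fNorm p) := by
    refine continuous_tsum (fun q => ?_) summable_half_pow_succ fun q x => ?_
    · exact continuous_const.mul
        (continuous_const.min (hX.withSeminorms.continuous_seminorm q))
    · rw [Real.norm_of_nonneg (fNorm_term_nonneg p x q)]
      exact fNorm_term_le p x q
  refine (isOpen_lt hcont continuous_const).mem_nhds ?_
  simpa [fNorm] using hε

theorem IsFrechetSequenceAlgebra.exists_fNorm_lt_imp_mem (hX : IsFrechetSequenceAlgebra coord p)
    {U : Set X} (hU : U ∈ 𝓝 (0 : X)) : ∃ ε > 0, ∀ x, fNorm p x < ε → x ∈ U := by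
  obtain ⟨q, η, hη, h⟩ := hX.exists_seminorm_lt_imp_mem hU
  refine ⟨(1 / 2 : ℝ) ^ (q + 1) * min 1 η, by positivity, fun x hx => h x ?_⟩
  have hsum : Summable fun q : ℕ => (1 / 2 : ℝ) ^ (q + 1) * min 1 (p q x) :=
    Summable.of_nonneg_of_le (fNorm_term_nonneg p x) (fNorm_term_le p x) summable_half_pow_succ
  have hlt := (hsum.le_tsum q fun j _ => fNorm_term_nonneg p x j).trans_lt hx
  have hmin := lt_of_mul_lt_mul_left hlt (by positivity)
  by_contra! hle
  exact hmin.not_ge (min_le_min_left 1 hle)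

end FNorm

section Solid

variable {X : Type*} [NonUnitalCommRing X] [Module ℂ X] [UniformSpace X]
  {coord : X →ₙₐ[ℂ] (ℕ → ℂ)} {e : ℕ → X} {R : ℕ → Seminorm ℂ X}

namespace IsSolidSystem

theorem ext (hR : IsSolidSystem coord e R) {x y : X} (h : ∀ n, coord x n = coord y n) : x = y :=
  hR.coord_injective (funext h)

theorem tendsto_sum_range (hR : IsSolidSystem coord e R) (x : X) :
    Tendsto (fun N => ∑ n ∈ Finset.range N, coord x n • e n) atTop (𝓝 x) :=
  (hR.hasSum_coord x).tendsto_sum_nat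

/-- The seminorm of a vector that is dominated by a multiple of another one. -/
theorem le_mul (hR : IsSolidSystem coord e R) (q : ℕ) {x y : X} {M : ℝ} (hM : 0 ≤ M)
    (h : ∀ n, ‖coord x n‖ ≤ M * ‖coord y n‖) : R q x ≤ M * R q y := by
  have := hR.solid q x ((M : ℂ) • y) fun n => by
    simpa [-Complex.coe_smul, map_smul, norm_mul, abs_of_nonneg hM] using h n
  simpa [-Complex.coe_smul, map_smul_eq_mul, abs_of_nonneg hM] using this

theorem sum_smul_le (hR : IsSolidSystem coord e R) (q : ℕ) (t : Finset ℕ) {a : ℕ → ℂ} {y : X}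
    (h : ∀ n ∈ t, ‖a n‖ ≤ ‖coord y n‖) : R q (∑ n ∈ t, a n • e n) ≤ R q y := by
  refine hR.solid q _ _ fun n => ?_
  rw [coord_sum_smul hR.coord_e]
  split_ifs with hn
  · exact h n hn
  · simp

variable [IsUniformAddGroup X]

theorem tendsto_nhds (hR : IsSolidSystem coord e R) {α : Type*} {l : Filter α} {f : α → X} {y : X} :
    Tendsto f l (𝓝 y) ↔ ∀ q, ∀ η > 0, ∀ᶠ z in l, R q (f z - y) < η := by
  rw [← tendsto_sub_nhds_zero_iff]
  constructor
  · intro h q η hη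
    exact h (seminorm_lt_mem_nhds (hR.continuous q) hη)
  · intro h U hU
    obtain ⟨q, η, hη, hU'⟩ := hR.exists_lt_imp_mem U hU
    exact (h q η hη).mono fun z hz => hU' _ hz

/-- Tails are small uniformly over all vectors dominated by `x`. -/
theorem exists_tail_lt (hR : IsSolidSystem coord e R) (x : X) (q : ℕ) {η : ℝ} (hη : 0 < η) :
    ∃ N, ∀ y : X, (∀ n < N, coord y n = 0) → (∀ n, ‖coord y n‖ ≤ ‖coord x n‖) → R q y < η := by
  obtain ⟨N, hN⟩ := ((hR.tendsto_nhds.1 (hR.tendsto_sum_range x)) q η hη).exists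
  refine ⟨N, fun y hy0 hyx => (hR.solid q y _ fun n => ?_).trans_lt hN⟩
  rw [map_sub, Pi.sub_apply, coord_sum_smul hR.coord_e]
  by_cases hn : n < N
  · simp [hy0 n hn]
  · simpa [hn] using hyx n

end IsSolidSystem

end Solid

/-! ### Products of weights and iterates of weighted shifts -/

section Weights

variable {w : ℕ → ℝ → ℝ} {I : Set ℝ} {a b c : ℝ}

theorem weightProd_mul_weightProd (w : ℕ → ℝ → ℝ) (a : ℝ) {i j k : ℕ} (hij : i ≤ j + 1)
    (hjk : j ≤ k) : weightProd w a i j * weightProd w a (j + 1) k = weightProd w a i k := by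
  simp only [weightProd, ← Finset.Ico_add_one_right_eq_Icc]
  exact Finset.prod_Ico_consecutive _ hij (by lia)

/-- Products of weights through the sums `f_n` of logarithms. -/
theorem weightProd_eq_exp (hpos : ∀ n, 1 ≤ n → 0 < w n a) {l n : ℕ} (hln : l ≤ n) :
    weightProd w a (l + 1) n = Real.exp (logSum w n a - logSum w l a) := by
  have h : ∀ n, Real.exp (logSum w n a) = weightProd w a 1 n := fun n => by
    rw [logSum, Real.exp_sum, weightProd]
    exact Finset.prod_congr rfl fun k hk => Real.exp_log (hpos k (Finset.mem_Icc.1 hk).1)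
  rw [Real.exp_sub, h, h, eq_div_iff, mul_comm, weightProd_mul_weightProd w a (by lia) hln]
  exact (h l ▸ Real.exp_pos _).ne'

theorem weightProd_pos (hpos : ∀ n, 1 ≤ n → 0 < w n a) {i j : ℕ} (hi : 1 ≤ i) :
    0 < weightProd w a i j :=
  Finset.prod_pos fun k hk => hpos k (hi.trans (Finset.mem_Icc.1 hk).1)

end Weights

/-- The standing properties of a family of weighted shifts `B a`, `a ∈ I`: the weights are positive,
depend continuously on the parameter, and their quotients are bounded below by `c`. -/
structure IsShiftFamily {X : Type*} [NonUnitalCommRing X] [Module ℂ X] [TopologicalSpace X]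
    (coord : X →ₙₐ[ℂ] (ℕ → ℂ)) (I : Set ℝ) (w : ℕ → ℝ → ℝ) (B : ℝ → X →L[ℂ] X) (c : ℝ) :
    Prop where
  coord_apply : ∀ a ∈ I, ∀ x n, coord (B a x) n = (w (n + 1) a : ℂ) * coord x (n + 1)
  weight_pos : ∀ a ∈ I, ∀ n, 1 ≤ n → 0 < w n a
  weight_continuousOn : ∀ n, 1 ≤ n → ContinuousOn (w n) I
  ratio_pos : 0 < c
  mul_weight_le : ∀ n, 1 ≤ n → ∀ a ∈ I, ∀ b ∈ I, c * w n b ≤ w n a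

namespace IsShiftFamily

variable {X : Type*} [NonUnitalCommRing X] [Module ℂ X] [UniformSpace X]
  {coord : X →ₙₐ[ℂ] (ℕ → ℂ)} {e : ℕ → X} {R : ℕ → Seminorm ℂ X}
  {w : ℕ → ℝ → ℝ} {I : Set ℝ} {B : ℝ → X →L[ℂ] X} {a b c : ℝ}

theorem coord_iterate (hB : IsShiftFamily coord I w B c) (ha : a ∈ I) (x : X) (n l : ℕ) :
    coord ((B a)^[n] x) l = (weightProd w a (l + 1) (l + n) : ℂ) * coord x (l + n) := by
  induction n generalizing l with
  | zero => simp [weightProd]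
  | succ n ih =>
    rw [Function.iterate_succ_apply', hB.coord_apply a ha, ih, ← mul_assoc, ← Complex.ofReal_mul,
      show l + 1 + n = l + (n + 1) by lia,
      ← weightProd_mul_weightProd w a (show l + 1 ≤ (l + 1) + 1 by lia)
        (show l + 1 ≤ l + (n + 1) by lia)]
    simp [weightProd]

theorem norm_coord_iterate (hB : IsShiftFamily coord I w B c) (ha : a ∈ I) (x : X) (n l : ℕ) :
    ‖coord ((B a)^[n] x) l‖ = weightProd w a (l + 1) (l + n) * ‖coord x (l + n)‖ := by
  rw [hB.coord_iterate ha, norm_mul, Complex.norm_real, Real.norm_of_nonneg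
    (weightProd_pos (hB.weight_pos a ha) (by lia)).le]

theorem pow_mul_weightProd_le (hB : IsShiftFamily coord I w B c) (ha : a ∈ I) (hb : b ∈ I)
    {i j : ℕ} (hi : 1 ≤ i) :
    c ^ (j + 1 - i) * weightProd w b i j ≤ weightProd w a i j := by
  rw [weightProd, weightProd, ← Nat.card_Icc, ← Finset.prod_const, ← Finset.prod_mul_distrib]
  refine Finset.prod_le_prod (fun k hk => ?_) fun k hk => ?_
  · have := hB.weight_pos b hb k (hi.trans (Finset.mem_Icc.1 hk).1)
    have := hB.ratio_pos
    positivity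
  · exact hB.mul_weight_le k (hi.trans (Finset.mem_Icc.1 hk).1) a ha b hb

theorem weightProd_continuousOn (hB : IsShiftFamily coord I w B c) {i j : ℕ} (hi : 1 ≤ i) :
    ContinuousOn (fun a => weightProd w a i j) I :=
  continuousOn_finsetProd _ fun k hk =>
    hB.weight_continuousOn k (hi.trans (Finset.mem_Icc.1 hk).1)

theorem apply_e_zero (hB : IsShiftFamily coord I w B c) (hR : IsSolidSystem coord e R)
    (ha : a ∈ I) : B a (e 0) = 0 :=
  hR.ext fun n => by simp [-Complex.coe_smul, hB.coord_apply a ha, hR.coord_e]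

theorem apply_e_succ (hB : IsShiftFamily coord I w B c) (hR : IsSolidSystem coord e R)
    (ha : a ∈ I) (n : ℕ) : B a (e (n + 1)) = (w (n + 1) a : ℂ) • e n :=
  hR.ext fun k => by
    by_cases h : k = n
    · subst h
      simp [-Complex.coe_smul, hB.coord_apply a ha, hR.coord_e]
    · simp [-Complex.coe_smul, hB.coord_apply a ha, hR.coord_e, h]

theorem seminorm_apply_le (hB : IsShiftFamily coord I w B c) (hR : IsSolidSystem coord e R)
    (ha : a ∈ I) (hb : b ∈ I) (q : ℕ) (x : X) : R q (B a x) ≤ c⁻¹ * R q (B b x) := by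
  refine hR.le_mul q (inv_pos.2 hB.ratio_pos).le fun n => ?_
  have h1 := hB.weight_pos a ha (n + 1) (by lia)
  have h2 := hB.weight_pos b hb (n + 1) (by lia)
  rw [hB.coord_apply a ha, hB.coord_apply b hb, norm_mul, norm_mul, Complex.norm_real,
    Complex.norm_real, Real.norm_of_nonneg h1.le, Real.norm_of_nonneg h2.le, ← mul_assoc]
  refine mul_le_mul_of_nonneg_right ?_ (norm_nonneg _)
  rw [← div_eq_inv_mul, le_div_iff₀' hB.ratio_pos]
  exact hB.mul_weight_le _ (by lia) b hb a ha

variable [IsUniformAddGroup X]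

/-- The shift depends continuously on the parameter and the vector jointly: the operators `B a` are
equicontinuous, and `a ↦ B a x` is continuous for `x` of finite support. -/
theorem continuous_apply (hB : IsShiftFamily coord I w B c) (hR : IsSolidSystem coord e R)
    [ContinuousSMul ℂ X] : Continuous fun z : I × X => B z.1 z.2 := by
  have hbasis : ∀ n, Continuous fun a : I => B a (e n) := by
    rintro (_ | n)
    · simp only [hB.apply_e_zero hR (Subtype.coe_prop _)]
      exact continuous_const
    · simp only [hB.apply_e_succ hR (Subtype.coe_prop _)]
      have := continuousOn_iff_continuous_domRestrict.1 (hB.weight_continuousOn (n + 1) (by lia))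
      exact (Complex.continuous_ofReal.comp this).smul continuous_const
  have hc := hB.ratio_pos
  rw [continuous_iff_continuousAt]
  rintro ⟨a₀, x₀⟩
  rw [ContinuousAt, hR.tendsto_nhds]
  intro q η hη
  set η' : ℝ := c * (η / 4) with hη'
  have hη'0 : 0 < η' := by positivity
  obtain ⟨N, hN⟩ := ((hR.tendsto_nhds.1 (((B a₀).continuous.tendsto x₀).comp
    (hR.tendsto_sum_range x₀))) q (min η' (η / 4)) (by positivity)).exists
  set x₁ := ∑ n ∈ Finset.range N, coord x₀ n • e n with hx₁
  simp only [Function.comp_apply] at hN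
  have hfin : Continuous fun a : I => B a x₁ := by
    simp only [hx₁, map_sum, map_smul]
    exact continuous_finsetSum _ fun n _ => (hbasis n).const_smul _
  have h1 : ∀ᶠ z : I × X in 𝓝 (a₀, x₀), R q (B z.1 x₁ - B a₀ x₁) < η / 4 :=
    hR.tendsto_nhds.1 ((hfin.comp continuous_fst).tendsto (a₀, x₀)) q _ (by positivity)
  have h2 : ∀ᶠ z : I × X in 𝓝 (a₀, x₀), R q (B a₀ z.2 - B a₀ x₀) < η' :=
    hR.tendsto_nhds.1 (((B a₀).continuous.comp continuous_snd).tendsto (a₀, x₀)) q _ hη'0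
  filter_upwards [h1, h2] with z hz1 hz2
  have h3 : R q (B z.1 (z.2 - x₁)) ≤ c⁻¹ * (η' + η') := by
    refine (hB.seminorm_apply_le hR z.1.2 a₀.2 q _).trans ?_
    refine mul_le_mul_of_nonneg_left ?_ (by positivity)
    have : B a₀ (z.2 - x₁) = (B a₀ z.2 - B a₀ x₀) - (B a₀ x₁ - B a₀ x₀) := by
      rw [map_sub]; abel
    rw [this]
    exact (map_sub_le_add _ _ _).trans (add_le_add hz2.le (hN.trans_le (min_le_left _ _)).le)
  have h4 : c⁻¹ * (η' + η') = η / 2 := by rw [hη']; field_simp; ring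
  have : B z.1 z.2 - B a₀ x₀ =
      B z.1 (z.2 - x₁) + (B z.1 x₁ - B a₀ x₁) + (B a₀ x₁ - B a₀ x₀) := by
    rw [map_sub]; abel
  rw [this]
  have h5 := map_add_le_add (R q) (B z.1 (z.2 - x₁) + (B z.1 x₁ - B a₀ x₁)) (B a₀ x₁ - B a₀ x₀)
  have h6 := map_add_le_add (R q) (B z.1 (z.2 - x₁)) (B z.1 x₁ - B a₀ x₁)
  have h7 := hN.trans_le (min_le_right _ _)
  linarith

theorem continuous_iterate (hB : IsShiftFamily coord I w B c) (hR : IsSolidSystem coord e R)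
    [ContinuousSMul ℂ X] (n : ℕ) : Continuous fun z : I × X => (B z.1)^[n] z.2 := by
  induction n with
  | zero => exact continuous_snd
  | succ n ih =>
    simp only [Function.iterate_succ_apply']
    exact (hB.continuous_apply hR).comp (continuous_fst.prodMk ih)

end IsShiftFamily

/-! ### Powers and finite sums of basis vectors -/

section Powers

theorem algPow_succ {Y : Type*} [Mul Y] (u : Y) {m : ℕ} (hm : 1 ≤ m) :
    algPow u (m + 1) = algPow u m * u := by
  obtain ⟨k, rfl⟩ := Nat.exists_eq_add_of_le' hm
  rfl

theorem algPow_apply {ι Y : Type*} [Mul Y] (u : ι → Y) (m : ℕ) (i : ι) :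
    algPow u m i = algPow (u i) m := by
  match m with
  | 0 => rfl
  | 1 => rfl
  | m + 2 => rw [algPow, algPow, Pi.mul_apply, algPow_apply u (m + 1) i]

variable {X : Type*} [NonUnitalCommRing X] [Module ℂ X] {coord : X →ₙₐ[ℂ] (ℕ → ℂ)} {e : ℕ → X}

theorem coord_algPow (coord : X →ₙₐ[ℂ] (ℕ → ℂ)) (x : X) {m : ℕ} (hm : 1 ≤ m) (n : ℕ) :
    coord (algPow x m) n = coord x n ^ m := by
  induction m, hm using Nat.le_induction with
  | base => simp [algPow]
  | succ m hm ih => rw [algPow_succ x hm, map_mul, Pi.mul_apply, ih, pow_succ]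

theorem coord_sum_comp_of_mem (he : ∀ n, coord (e n) = Pi.single n 1) {T : Finset ℕ} {g : ℕ → ℕ}
    (hg : InjOn g T) (a : ℕ → ℂ) {k : ℕ} (hk : k ∈ T) :
    coord (∑ j ∈ T, a j • e (g j)) (g k) = a k := by
  simp only [map_sum, Finset.sum_apply, map_smul, he, Pi.smul_apply]
  rw [Finset.sum_eq_single_of_mem k hk]
  · simp
  · intro j hj hjk
    rw [Pi.single_eq_of_ne (fun h => hjk (hg hj hk h.symm)), smul_zero]

theorem coord_sum_comp_of_ne (he : ∀ n, coord (e n) = Pi.single n 1) {T : Finset ℕ} {g : ℕ → ℕ}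
    (a : ℕ → ℂ) {n : ℕ} (hn : ∀ k ∈ T, g k ≠ n) :
    coord (∑ j ∈ T, a j • e (g j)) n = 0 := by
  simp only [map_sum, Finset.sum_apply, map_smul, he, Pi.smul_apply]
  exact Finset.sum_eq_zero fun j hj => by
    rw [Pi.single_eq_of_ne (hn j hj).symm, smul_zero]

theorem norm_coord_sum_comp_le (he : ∀ n, coord (e n) = Pi.single n 1) {T : Finset ℕ} {g : ℕ → ℕ}
    (hg : InjOn g T) {a : ℕ → ℂ} {y : X} (h : ∀ k ∈ T, ‖a k‖ ≤ ‖coord y (g k)‖) (n : ℕ) :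
    ‖coord (∑ j ∈ T, a j • e (g j)) n‖ ≤ ‖coord y n‖ := by
  by_cases hn : ∃ k ∈ T, g k = n
  · obtain ⟨k, hk, rfl⟩ := hn
    rw [coord_sum_comp_of_mem he hg a hk]
    exact h k hk
  · push Not at hn
    rw [coord_sum_comp_of_ne he a hn, norm_zero]
    exact norm_nonneg _

end Powers

theorem exists_increasing_enumeration (S : Finset ℕ) : ∃ n : ℕ → ℕ,
    (∀ k ∈ Finset.Icc 1 S.card, n k ∈ S) ∧
    (∀ j k, 1 ≤ j → j < k → k ≤ S.card → n j < n k) ∧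
    ∀ s ∈ S, ∃ k ∈ Finset.Icc 1 S.card, n k = s := by
  refine ⟨fun k => if h : k - 1 < S.card then S.orderEmbOfFin rfl ⟨k - 1, h⟩ else 0,
    fun k hk => ?_, fun j k hj hjk hk => ?_, fun s hs => ?_⟩
  · rw [Finset.mem_Icc] at hk
    simp only [show k - 1 < S.card by lia, dite_true]
    exact S.orderEmbOfFin_mem rfl _
  · simp only [show j - 1 < S.card by lia, show k - 1 < S.card by lia, dite_true]
    exact (S.orderEmbOfFin rfl).strictMono (Fin.mk_lt_mk.2 (by lia))
  · rw [← Finset.mem_coe, ← S.range_orderEmbOfFin rfl] at hs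
    obtain ⟨k, rfl⟩ := hs
    exact ⟨k + 1, by simp [k.2], by simp⟩

theorem algPow_mem {Y : Type*} [NonUnitalCommRing Y] [Module ℂ Y] (A : NonUnitalSubalgebra ℂ Y)
    {u : Y} (hu : u ∈ A) (m : ℕ) : algPow u m ∈ A := by
  match m with
  | 0 => exact hu
  | 1 => exact hu
  | m + 2 => exact A.mul_mem (algPow_mem A hu (m + 1)) hu

/-- A power of a non-zero generator is a non-zero element of the algebra. -/
theorem HasCommonHypercyclicAlgebra.exists_algPow {X : Type*} [NonUnitalCommRing X] [Module ℂ X]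
    [TopologicalSpace X] {ι κ : Type*} {T : ι → (κ → X) → (κ → X)} {Λ : Set ι}
    {coord : X →ₙₐ[ℂ] (ℕ → ℂ)} (hcoord : Function.Injective coord)
    (h : HasCommonHypercyclicAlgebra T Λ) {m : ℕ} (hm : 1 ≤ m) :
    ∃ u : κ → X, IsCommonHypercyclicVector T Λ (algPow u m) := by
  obtain ⟨A, ⟨y, hyA, hy⟩, hA⟩ := h
  refine ⟨y, hA _ (algPow_mem A hyA m) fun h0 => hy (funext fun i => hcoord (funext fun n => ?_))⟩
  have h1 : coord (algPow (y i) m) n = 0 := by simp [← algPow_apply, h0]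
  rw [coord_algPow coord _ hm] at h1
  simpa using eq_zero_of_pow_eq_zero h1

/-- The covering condition on the compact subsets of `Λ`, with smallness expressed by neighbourhoods
of zero. -/
def CoverCondition {X : Type*} [NonUnitalCommRing X] [Module ℂ X] [TopologicalSpace X] {d : ℕ}
    (e : ℕ → X) (I : Set ℝ) (w : ℕ → ℝ → ℝ) (F : ℕ → ℝ) (Λ : Set (Fin d → ℝ)) (m : ℕ) : Prop :=
  ∀ τ : ℝ, 0 < τ → ∀ N : ℕ, 1 ≤ N → ∀ U ∈ 𝓝 (0 : X),
    ∀ K : Set (Fin d → ℝ), K ⊆ Λ → IsCompact K →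
    ∃ (q : ℕ) (n : ℕ → ℕ) (lam : ℕ → Fin d → ℝ),
      (1 ≤ q → N ≤ n 1) ∧
      (∀ k, 1 ≤ k → k < q → n k + N ≤ n (k + 1)) ∧
      (∀ k ∈ Finset.Icc 1 q, ∀ i, lam k i ∈ I) ∧
      (K ⊆ ⋃ k ∈ Finset.Icc 1 q,
        Set.pi Set.univ fun l => tagInterval τ (F (n k)) (lam k l)) ∧
      (∀ i : Fin d,
        ∑ k ∈ Finset.Icc 1 q,
          ((1 / weightProd w (lam k i) 1 (n k) ^ (1 / (m : ℝ)) : ℝ) : ℂ) • e (n k) ∈ U) ∧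
      (∀ k ∈ Finset.Icc 1 q, ∀ i : Fin d, ∀ l : ℕ, l ≤ N →
        ∑ j ∈ Finset.Icc (k + 1) q,
          ((weightProd w (lam k i) (n j - n k + l + 1) (n j + l) /
            weightProd w (lam j i) (l + 1) (n j + l) : ℝ) : ℂ) • e (n j - n k + l) ∈ U)

/-! ### From hypercyclic powers to the covering condition -/

section Necessity

variable {X : Type*} [NonUnitalCommRing X] [Module ℂ X] {coord : X →ₙₐ[ℂ] (ℕ → ℂ)} {e : ℕ → X}
  {w : ℕ → ℝ → ℝ} {I : Set ℝ} {a b c : ℝ}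

/-- The vector `2 (e_0 + ⋯ + e_N)`, near which the orbit is observed. -/
noncomputable def target (e : ℕ → X) (N : ℕ) : X := ∑ l ∈ Finset.range (N + 1), (2 : ℂ) • e l

theorem coord_target (he : ∀ n, coord (e n) = Pi.single n 1) (N l : ℕ) :
    coord (target e N) l = if l ≤ N then 2 else 0 := by
  rw [target, coord_sum_smul he]
  simp

variable [UniformSpace X] {R : ℕ → Seminorm ℂ X} {B : ℝ → X →L[ℂ] X}

theorem bounds_of_near_target (hB : IsShiftFamily coord I w B c) (hR : IsSolidSystem coord e R)
    (ha : a ∈ I) {q N n : ℕ} {δ : ℝ} {x : X} (h : R q ((B a)^[n] x - target e N) < δ) {l : ℕ}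
    (hl : l ≤ N) :
    2 - δ ≤ weightProd w a (l + 1) (l + n) * ‖coord x (l + n)‖ ∧
      weightProd w a (l + 1) (l + n) * ‖coord x (l + n)‖ ≤ 2 + δ := by
  have h1 := (hR.norm_coord_le q _ l).trans h.le
  rw [map_sub, Pi.sub_apply, coord_target hR.coord_e, if_pos hl] at h1
  rw [← hB.norm_coord_iterate ha]
  have h2 := norm_sub_norm_le (coord ((B a)^[n] x) l) 2
  have h3 := norm_sub_norm_le 2 (coord ((B a)^[n] x) l)
  rw [norm_sub_rev] at h3
  norm_num at h2 h3
  constructor <;> linarith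

theorem le_of_near_target (hB : IsShiftFamily coord I w B c) (hR : IsSolidSystem coord e R)
    (ha : a ∈ I) {q N n : ℕ} {δ : ℝ} {x : X} (h : R q ((B a)^[n] x - target e N) < δ) {l : ℕ}
    (hl : N < l) : weightProd w a (l + 1) (l + n) * ‖coord x (l + n)‖ ≤ δ := by
  have h1 := (hR.norm_coord_le q _ l).trans h.le
  rw [map_sub, Pi.sub_apply, coord_target hR.coord_e, if_neg hl.not_ge, sub_zero] at h1
  rwa [← hB.norm_coord_iterate ha]

theorem seminorm_tail_le_of_near_target (hB : IsShiftFamily coord I w B c)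
    (hR : IsSolidSystem coord e R) (ha : a ∈ I) {q N n : ℕ} {δ : ℝ} {x : X}
    (h : R q ((B a)^[n] x - target e N) < δ) {t : Finset ℕ} (ht : ∀ l ∈ t, N < l) :
    R q (∑ l ∈ t, ((weightProd w a (l + 1) (l + n) : ℂ) * coord x (l + n)) • e l) ≤ δ := by
  refine (hR.sum_smul_le q t fun l hl => ?_).trans h.le
  rw [map_sub, Pi.sub_apply, coord_target hR.coord_e, if_neg (ht l hl).not_ge, sub_zero,
    hB.coord_iterate ha]

/-- Two iterates whose exponents differ by `r ∈ [1, N]` are not both close to the target, whatever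
the parameters: the coordinates at `n + r` force the two products of weights to be comparable,
the coordinates at `n + r + N` forbid it. -/
theorem not_near_target_of_near_target (hB : IsShiftFamily coord I w B c)
    (hR : IsSolidSystem coord e R) {a₀ : ℝ} (ha₀ : a₀ ∈ I) (ha : a ∈ I) (hb : b ∈ I)
    {q N n r : ℕ} {δ : ℝ} (hδ1 : δ ≤ 1) (hr1 : 1 ≤ r) (hrN : r ≤ N)
    (hδ : 3 * δ * weightProd w a₀ (r + 1) (r + N) < c ^ (3 * N) * weightProd w a₀ 1 N) {x : X}
    (hna : R q ((B a)^[n] x - target e N) < δ) :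
    ¬ R q ((B b)^[n + r] x - target e N) < δ := by
  intro hnb
  have hδ0 : 0 < δ := (apply_nonneg _ _).trans_lt hna
  have hc := hB.ratio_pos
  have a1 := (bounds_of_near_target hB hR ha hna hrN).1
  have b1 := (bounds_of_near_target hB hR hb hnb (Nat.zero_le N)).2
  have a2 := le_of_near_target hB hR ha hna (show N < r + N by lia)
  have b2 := (bounds_of_near_target hB hR hb hnb le_rfl).1
  rw [show r + n = n + r by lia] at a1
  rw [zero_add, zero_add] at b1
  rw [show r + N + n = n + r + N by lia] at a2
  rw [show N + (n + r) = n + r + N by lia] at b2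
  have ea1 := weightProd_mul_weightProd w a (show r + 1 ≤ r + N + 1 by lia)
    (show r + N ≤ n + r + N by lia)
  have ea2 := weightProd_mul_weightProd w a (show r + 1 ≤ n + r + 1 by lia)
    (show n + r ≤ n + r + N by lia)
  have eb1 := weightProd_mul_weightProd w b (show 1 ≤ N + 1 by lia) (show N ≤ n + r + N by lia)
  have eb2 := weightProd_mul_weightProd w b (show 1 ≤ n + r + 1 by lia)
    (show n + r ≤ n + r + N by lia)
  have r1 := hB.pow_mul_weightProd_le ha hb (show 1 ≤ n + r + 1 by lia) (j := n + r + N)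
  have r2 := hB.pow_mul_weightProd_le ha₀ ha (show 1 ≤ r + 1 by lia) (j := r + N)
  have r3 := hB.pow_mul_weightProd_le hb ha₀ le_rfl (j := N)
  rw [show n + r + N + 1 - (n + r + 1) = N by lia] at r1
  rw [show r + N + 1 - (r + 1) = N by lia] at r2
  rw [show N + 1 - 1 = N by lia] at r3
  have hpa : ∀ i j, 0 < weightProd w a (i + 1) j :=
    fun i j => weightProd_pos (hB.weight_pos a ha) (by lia)
  have hpb : ∀ i j, 0 < weightProd w b (i + 1) j :=
    fun i j => weightProd_pos (hB.weight_pos b hb) (by lia)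
  have p1 := hpa r (n + r)
  have p2 := hpa (r + N) (n + r + N)
  have p3 := hpa r (r + N)
  have p4 := hpa (n + r) (n + r + N)
  have p5 := hpb N (n + r + N)
  have p6 := hpb 0 (n + r)
  have p7 := hpb (n + r) (n + r + N)
  have p8 := hpb 0 N
  rw [zero_add] at p6 p8
  set A1 := weightProd w a (r + 1) (n + r)
  set A2 := weightProd w a (r + N + 1) (n + r + N)
  set A3 := weightProd w a (r + 1) (r + N)
  set A4 := weightProd w a (n + r + 1) (n + r + N)
  set B1 := weightProd w b 1 (n + r)
  set B2 := weightProd w b (N + 1) (n + r + N)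
  set B3 := weightProd w b 1 N
  set B4 := weightProd w b (n + r + 1) (n + r + N)
  set Z := weightProd w a₀ (r + 1) (r + N)
  set Z' := weightProd w a₀ 1 N
  set x1 := ‖coord x (n + r)‖
  set x2 := ‖coord x (n + r + N)‖
  have hcN : 0 < c ^ N := by positivity
  have hx1 : 0 < x1 := by
    refine lt_of_le_of_ne (norm_nonneg _) fun h => ?_
    rw [← h] at a1; linarith
  have hx2 : 0 < x2 := by
    refine lt_of_le_of_ne (norm_nonneg _) fun h => ?_
    rw [← h] at b2; linarith
  have k1 : B1 ≤ 3 * A1 := by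
    refine le_of_mul_le_mul_right ?_ hx1
    linarith
  have k2 : A2 ≤ δ * B2 := by
    refine le_of_mul_le_mul_right ?_ hx2
    nlinarith
  have k3 : A1 * A4 * B3 ≤ δ * (B1 * B4) * A3 := by
    have : A3 * A2 * B3 ≤ A3 * (δ * B2) * B3 := by gcongr
    calc A1 * A4 * B3 = A3 * A2 * B3 := by rw [ea1, ea2]
      _ ≤ A3 * (δ * B2) * B3 := this
      _ = δ * (B3 * B2) * A3 := by ring
      _ = δ * (B1 * B4) * A3 := by rw [eb1, eb2]
  have k4 : (A1 * A4) * (c ^ N * B3) ≤ (A1 * A4) * (3 * δ * A3) := by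
    calc (A1 * A4) * (c ^ N * B3) = c ^ N * (A1 * A4 * B3) := by ring
      _ ≤ c ^ N * (δ * (B1 * B4) * A3) := by gcongr
      _ = δ * B1 * (c ^ N * B4) * A3 := by ring
      _ ≤ δ * (3 * A1) * A4 * A3 := by gcongr
      _ = _ := by ring
  have k5 : c ^ N * B3 ≤ 3 * δ * A3 := le_of_mul_le_mul_left k4 (by positivity)
  have k6 : c ^ N * (c ^ N * (c ^ N * Z')) ≤ 3 * δ * Z := by
    calc c ^ N * (c ^ N * (c ^ N * Z')) ≤ c ^ N * (c ^ N * B3) := by gcongr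
      _ ≤ c ^ N * (3 * δ * A3) := by gcongr
      _ = 3 * δ * (c ^ N * A3) := by ring
      _ ≤ 3 * δ * Z := by gcongr
  have : c ^ (3 * N) * Z' = c ^ N * (c ^ N * (c ^ N * Z')) := by ring
  linarith

end Necessity

section Necessity

theorem IsHypercyclicVector.exists_iterate_mem {Y : Type*} [TopologicalSpace Y] [T1Space Y]
    [∀ y : Y, (𝓝[≠] y).NeBot] {T : Y → Y} {y : Y} (h : IsHypercyclicVector T y) {V : Set Y}
    (hV : IsOpen V) (hne : V.Nonempty) (n₀ : ℕ) : ∃ n, n₀ ≤ n ∧ T^[n] y ∈ V := by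
  classical
  have hd := Dense.sdiff_finset h ((Finset.range n₀).image fun n => T^[n] y)
  obtain ⟨z, hzV, ⟨n, -, rfl⟩, hz⟩ := hd.inter_open_nonempty V hV hne
  refine ⟨n, ?_, hzV⟩
  by_contra! hn
  exact hz (Finset.mem_coe.2 (Finset.mem_image_of_mem _ (Finset.mem_range.2 hn)))

theorem iterate_prodOp {X : Type*} [AddCommGroup X] [Module ℂ X] [TopologicalSpace X] {d : ℕ}
    (B : ℝ → X →L[ℂ] X) (lam : Fin d → ℝ) (n : ℕ) (v : Fin d → X) (i : Fin d) :
    (prodOp B lam)^[n] v i = (B (lam i))^[n] (v i) := by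
  induction n generalizing v with
  | zero => rfl
  | succ n ih => rw [Function.iterate_succ_apply, Function.iterate_succ_apply, ih]; rfl

/-- A tolerance small enough for the covering argument: the factor `(2 + δ) / (2 - δ)` is at most `exp σ`, and
the condition of `not_near_target_of_near_target` holds for all shifts `r`. -/
theorem exists_delta {σ η Z' : ℝ} (hσ : 0 < σ) (hη : 0 < η) (hZ' : 0 < Z') (Z : ℕ → ℝ) (N : ℕ) :
    ∃ δ > 0, δ ≤ 1 ∧ δ < η ∧ 2 + δ ≤ (2 - δ) * Real.exp σ ∧
      ∀ r ∈ Finset.Icc 1 N, 3 * δ * Z r < Z' := by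
  have key : ∀ f : ℝ → ℝ, Continuous f → f 0 < 0 → ∀ᶠ δ in 𝓝[>] (0 : ℝ), f δ < 0 :=
    fun f hf h0 => nhdsWithin_le_nhds ((hf.tendsto 0).eventually (Iio_mem_nhds h0))
  have h1 := key (fun δ => δ - 1) (by fun_prop) (by norm_num)
  have h2 := key (fun δ => δ - η) (by fun_prop) (by linarith)
  have h3 := key (fun δ => 2 + δ - (2 - δ) * Real.exp σ) (by fun_prop)
    (by have := Real.one_lt_exp_iff.2 hσ; linarith)
  have h4 : ∀ᶠ δ in 𝓝[>] (0 : ℝ), ∀ r ∈ Finset.Icc 1 N, 3 * δ * Z r - Z' < 0 :=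
    (Filter.eventually_all_finset _).2 fun r _ => key _ (by fun_prop) (by linarith)
  obtain ⟨δ, h1, h2, h3, h4, h0⟩ :=
    (h1.and (h2.and (h3.and (h4.and self_mem_nhdsWithin)))).exists
  exact ⟨δ, h0, by linarith, by linarith, by linarith, fun r hr => by linarith [h4 r hr]⟩

theorem le_of_mem_closure_of_continuousOn {f : ℝ → ℝ} {s I : Set ℝ} {a M : ℝ} (hsI : s ⊆ I)
    (ha : a ∈ closure s) (haI : a ∈ I) (hf : ContinuousOn f I) (h : ∀ b ∈ s, f b ≤ M) : f a ≤ M :=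
  ContinuousWithinAt.closure_le ha ((hf a haI).mono hsI) continuousWithinAt_const h

variable {X : Type*} [NonUnitalCommRing X] [Module ℂ X] [UniformSpace X] [IsUniformAddGroup X]
  {coord : X →ₙₐ[ℂ] (ℕ → ℂ)} {e : ℕ → X} {R : ℕ → Seminorm ℂ X}
  {w : ℕ → ℝ → ℝ} {I : Set ℝ} {B : ℝ → X →L[ℂ] X} {c : ℝ}

/-- The estimates of `bounds_of_near_target` and `seminorm_tail_le_of_near_target` involve finitely
many coordinates, so they pass to limits of parameters. -/
theorem bounds_of_mem_closure (hB : IsShiftFamily coord I w B c) (hR : IsSolidSystem coord e R)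
    [ContinuousSMul ℂ X] {q N n : ℕ} {δ : ℝ} {x : X} {s : Set ℝ} (hsI : s ⊆ I)
    (hs : ∀ a ∈ s, R q ((B a)^[n] x - target e N) < δ) {a : ℝ} (ha : a ∈ closure s) (haI : a ∈ I) :
    (∀ l ≤ N, 2 - δ ≤ weightProd w a (l + 1) (l + n) * ‖coord x (l + n)‖ ∧
      weightProd w a (l + 1) (l + n) * ‖coord x (l + n)‖ ≤ 2 + δ) ∧
    ∀ t : Finset ℕ, (∀ l ∈ t, N < l) →
      R q (∑ l ∈ t, ((weightProd w a (l + 1) (l + n) : ℂ) * coord x (l + n)) • e l) ≤ δ := by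
  have hcont : ∀ l, ContinuousOn (fun a => weightProd w a (l + 1) (l + n)) I := fun l =>
    hB.weightProd_continuousOn (by lia)
  refine ⟨fun l hl => ⟨?_, ?_⟩, fun t ht => ?_⟩
  · refine neg_le_neg_iff.1 (le_of_mem_closure_of_continuousOn (f := fun a =>
      -(weightProd w a (l + 1) (l + n) * ‖coord x (l + n)‖)) hsI ha haI
      ((hcont l).mul continuousOn_const).neg fun b hb => ?_)
    exact neg_le_neg (bounds_of_near_target hB hR (hsI hb) (hs b hb) hl).1
  · exact le_of_mem_closure_of_continuousOn (f := fun a =>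
      weightProd w a (l + 1) (l + n) * ‖coord x (l + n)‖) hsI ha haI
      ((hcont l).mul continuousOn_const) fun b hb =>
        (bounds_of_near_target hB hR (hsI hb) (hs b hb) hl).2
  · refine le_of_mem_closure_of_continuousOn (f := fun a =>
      R q (∑ l ∈ t, ((weightProd w a (l + 1) (l + n) : ℂ) * coord x (l + n)) • e l)) hsI ha haI
      ((hR.continuous q).comp_continuousOn ?_) fun b hb =>
        seminorm_tail_le_of_near_target hB hR (hsI hb) (hs b hb) ht
    exact continuousOn_finsetSum _ fun l _ =>
      ((Complex.continuous_ofReal.comp_continuousOn (hcont l)).mul continuousOn_const).smul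
        continuousOn_const

variable {d : ℕ} {Λ : Set (Fin d → ℝ)} {F : ℕ → ℝ} {c' : ℝ}

/-- The boxes are spanned by the parameters for which a given iterate of `u ^ m` is close to the
target; their upper corners are suprema, at which the finite-coordinate estimates persist. -/
theorem coverCondition_of_isCommonHypercyclicVector_algPow (hB : IsShiftFamily coord I w B c)
    (hR : IsSolidSystem coord e R) [ContinuousSMul ℂ X] [T2Space X] (hI : I.Nonempty) (hd : 1 ≤ d)
    (hΛI : ∀ lam ∈ Λ, ∀ i, lam i ∈ I) (hc' : 0 < c')
    (hf : ∀ n, 1 ≤ n → ∀ a ∈ I, ∀ b ∈ I, c' * F n * |a - b| ≤ |logSum w n a - logSum w n b|)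
    {m : ℕ} (hm : 1 ≤ m) {u : Fin d → X}
    (hu : IsCommonHypercyclicVector (prodOp (d := d) B) Λ (algPow u m)) :
    CoverCondition e I w F Λ m := by
  classical
  intro τ hτ N hN U hU K hKΛ hK
  obtain ⟨q₀, η, hη, hηU⟩ := hR.exists_lt_imp_mem U hU
  obtain ⟨a₀, ha₀⟩ := hI
  have hc := hB.ratio_pos
  have hKI : ∀ lam ∈ K, ∀ i, lam i ∈ I := fun lam h => hΛI lam (hKΛ h)
  obtain ⟨δ, hδ0, hδ1, hδη, hδτ, hδN⟩ := exists_delta (mul_pos hc' hτ) hη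
    (mul_pos (pow_pos hc (3 * N)) (weightProd_pos (hB.weight_pos a₀ ha₀) le_rfl))
    (fun r => weightProd w a₀ (r + 1) (r + N)) N (Z' := c ^ (3 * N) * weightProd w a₀ 1 N)
  choose tail htail using fun i => hR.exists_tail_lt (u i) q₀ hη
  set v := algPow u m with hv
  -- Iterates of order at least `n₀` only see the tails of the components of `u`.
  set n₀ : ℕ := max N (Finset.univ.sup tail) with hn₀
  let E : ℕ → Set K := fun n => {lam | ∀ i, R q₀ ((B (lam.1 i))^[n] (v i) - target e N) < δ}
  have hEopen : ∀ n, IsOpen (E n) := by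
    intro n
    simp only [E, ofPred_forall]
    refine isOpen_iInter_of_finite fun i => isOpen_lt ((hR.continuous q₀).comp ?_) continuous_const
    refine Continuous.sub ?_ continuous_const
    have h1 : Continuous fun lam : K => ((⟨lam.1 i, hKI lam.1 lam.2 i⟩ : I), v i) :=
      (((continuous_apply i).comp continuous_subtype_val).subtype_mk _).prodMk continuous_const
    exact (hB.continuous_iterate hR n).comp h1
  have : Nontrivial X := ⟨e 0, 0, fun h => by simpa [hR.coord_e] using congrFun (congrArg coord h) 0⟩
  have : Nonempty (Fin d) := ⟨⟨0, hd⟩⟩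
  have hperf : ∀ y : Fin d → X, (𝓝[≠] y).NeBot := fun y => Module.punctured_nhds_neBot ℂ _ y
  have hEcover : ∀ lam : K, ∃ n, n₀ ≤ n ∧ lam ∈ E n := by
    intro lam
    have hopen : IsOpen {y : Fin d → X | ∀ i, R q₀ (y i - target e N) < δ} := by
      simp only [ofPred_forall]
      exact isOpen_iInter_of_finite fun i => isOpen_lt
        ((hR.continuous q₀).comp ((continuous_apply i).sub continuous_const)) continuous_const
    obtain ⟨n, hn, h⟩ := (hu lam.1 (hKΛ lam.2)).exists_iterate_mem hopen
      ⟨fun _ => target e N, fun i => by simpa using hδ0⟩ n₀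
    exact ⟨n, hn, fun i => by simpa [iterate_prodOp] using h i⟩
  have : CompactSpace K := isCompact_iff_compactSpace.1 hK
  obtain ⟨t, ht⟩ := isCompact_univ.elim_finite_subcover (fun n : {n // n₀ ≤ n} => E n)
    (fun n => hEopen n) fun lam _ => by
      obtain ⟨n, hn, h⟩ := hEcover lam
      exact mem_iUnion.2 ⟨⟨n, hn⟩, h⟩
  set S : Finset ℕ := (t.image Subtype.val).filter fun n => (E n).Nonempty with hS
  have hS1 : ∀ n ∈ S, n₀ ≤ n ∧ (E n).Nonempty := by
    intro n hn
    obtain ⟨h1, h2⟩ := Finset.mem_filter.1 hn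
    obtain ⟨k, -, rfl⟩ := Finset.mem_image.1 h1
    exact ⟨k.2, h2⟩
  have hS2 : ∀ lam : K, ∃ n ∈ S, lam ∈ E n := by
    intro lam
    obtain ⟨k, hk, h⟩ := mem_iUnion₂.1 (ht (mem_univ lam))
    exact ⟨k, Finset.mem_filter.2 ⟨Finset.mem_image_of_mem _ hk, ⟨lam, h⟩⟩, h⟩
  obtain ⟨n, hnS, hnmono, hnsurj⟩ := exists_increasing_enumeration S
  have hn₀n : ∀ k ∈ Finset.Icc 1 S.card, n₀ ≤ n k := fun k hk => (hS1 _ (hnS k hk)).1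
  have hNn : ∀ k ∈ Finset.Icc 1 S.card, N ≤ n k := fun k hk => (le_max_left _ _).trans (hn₀n k hk)
  -- The gaps exceed `N`.
  have hgap : ∀ j k, 1 ≤ j → j < k → k ≤ S.card → n j + N < n k := by
    intro j k hj hjk hk
    by_contra! hle
    have hlt := hnmono j k hj hjk hk
    obtain ⟨lam, hlam⟩ := (hS1 _ (hnS j (Finset.mem_Icc.2 ⟨hj, by lia⟩))).2
    obtain ⟨lam', hlam'⟩ := (hS1 _ (hnS k (Finset.mem_Icc.2 ⟨by lia, hk⟩))).2
    have h2 := hlam' ⟨0, hd⟩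
    rw [show n k = n j + (n k - n j) by lia] at h2
    exact not_near_target_of_near_target hB hR ha₀ (hKI _ lam.2 _) (hKI _ lam'.2 _) hδ1
      (by lia) (by lia) (hδN _ (Finset.mem_Icc.2 ⟨by lia, by lia⟩)) (hlam _) h2
  -- The box of `n k` has the coordinatewise supremum of `E (n k)` as its upper corner.
  let s : ℕ → Fin d → Set ℝ := fun k i => (fun lam : K => lam.1 i) '' E (n k)
  have hsK : ∀ k i, s k i ⊆ (fun lam : Fin d → ℝ => lam i) '' K := by
    rintro k i _ ⟨lam, -, rfl⟩
    exact ⟨lam.1, lam.2, rfl⟩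
  have hKi : ∀ i, IsCompact ((fun lam : Fin d → ℝ => lam i) '' K) := fun i =>
    hK.image (continuous_apply i)
  have hKiI : ∀ i, (fun lam : Fin d → ℝ => lam i) '' K ⊆ I := by
    rintro i _ ⟨lam, hlam, rfl⟩
    exact hKI lam hlam i
  have hsbdd : ∀ k i, BddAbove (s k i) := fun k i => (hKi i).bddAbove.mono (hsK k i)
  have hsI : ∀ k i, s k i ⊆ I := fun k i => (hsK k i).trans (hKiI i)
  let lam : ℕ → Fin d → ℝ := fun k i => sSup (s k i)
  have hlamcl : ∀ k ∈ Finset.Icc 1 S.card, ∀ i, lam k i ∈ closure (s k i) := fun k hk i =>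
    csSup_mem_closure ((hS1 _ (hnS k hk)).2.image _) (hsbdd k i)
  have hlamI : ∀ k ∈ Finset.Icc 1 S.card, ∀ i, lam k i ∈ I := fun k hk i =>
    hKiI i (closure_minimal (hsK k i) (hKi i).isClosed (hlamcl k hk i))
  have hlim := fun k hk i => bounds_of_mem_closure hB hR (hsI k i) (q := q₀) (N := N) (n := n k)
    (δ := δ) (x := v i) (by rintro _ ⟨lam, h, rfl⟩; exact h i) (hlamcl k hk i) (hlamI k hk i)
  have hvcoord : ∀ i j, coord (v i) j = coord (u i) j ^ m := fun i j => by
    rw [hv, algPow_apply, coord_algPow coord _ hm]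
  have hninj : InjOn n (Finset.Icc 1 S.card : Finset ℕ) := by
    intro j hj k hk h
    rw [Finset.mem_coe, Finset.mem_Icc] at hj hk
    rcases lt_trichotomy j k with hjk | hjk | hjk
    · exact absurd h (hnmono j k hj.1 hjk hk.2).ne
    · exact hjk
    · exact absurd h (hnmono k j hk.1 hjk hj.2).ne'
  refine ⟨S.card, n, lam, fun h => hNn 1 (Finset.mem_Icc.2 ⟨le_rfl, h⟩), fun k hk hkq =>
    (hgap k (k + 1) hk (by lia) (by lia)).le, hlamI, fun x hx => ?_, fun i => ?_, ?_⟩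
  · obtain ⟨n', hn'S, hxn'⟩ := hS2 ⟨x, hx⟩
    obtain ⟨k, hk, rfl⟩ := hnsurj n' hn'S
    refine mem_iUnion₂.2 ⟨k, hk, fun i _ => ?_⟩
    have hxs : x i ∈ s k i := ⟨⟨x, hx⟩, hxn', rfl⟩
    have hle : x i ≤ lam k i := le_csSup (hsbdd k i) hxs
    refine ⟨hle, ?_⟩
    have hn1 : 1 ≤ n k := hN.trans (hNn k hk)
    obtain ⟨h1, h2⟩ := (hlim k hk i).1 0 (Nat.zero_le _)
    obtain ⟨h3, h4⟩ := bounds_of_near_target hB hR (hsI k i hxs) (hxn' i) (Nat.zero_le N)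
    -- Two parameters with nearly the same value of the observed coordinate have nearly the same
    -- product of weights.
    have hbound : ∀ {a b y : ℝ}, a ∈ I → b ∈ I → 0 ≤ y →
        2 - δ ≤ weightProd w a (0 + 1) (0 + n k) * y →
        weightProd w b (0 + 1) (0 + n k) * y ≤ 2 + δ →
        logSum w (n k) b - logSum w (n k) a ≤ c' * τ := by
      intro a b y ha hb hy h1 h2
      have hy0 : 0 < y := lt_of_le_of_ne hy fun h => by rw [← h] at h1; linarith
      rw [weightProd_eq_exp (hB.weight_pos _ ha) (Nat.zero_le _)] at h1
      rw [weightProd_eq_exp (hB.weight_pos _ hb) (Nat.zero_le _)] at h2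
      simp only [logSum, Finset.Icc_eq_empty (show ¬ 1 ≤ 0 by lia), Finset.sum_empty, sub_zero,
        zero_add] at h1 h2
      rw [← Real.exp_le_exp, Real.exp_sub, div_le_iff₀ (Real.exp_pos _)]
      refine le_of_mul_le_mul_right ?_ hy0
      refine h2.trans (hδτ.trans ?_)
      rw [mul_comm (2 - δ), mul_assoc]
      exact mul_le_mul_of_nonneg_left h1 (Real.exp_pos _).le
    have h5 := hbound (hsI k i hxs) (hlamI k hk i) (norm_nonneg _) h3 h2
    have h6 := hbound (hlamI k hk i) (hsI k i hxs) (norm_nonneg _) h1 h4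
    have h7 := hf (n k) hn1 _ (hlamI k hk i) _ (hsI k i hxs)
    rw [abs_of_nonneg (sub_nonneg.2 hle), mul_assoc] at h7
    exact le_of_mul_le_mul_left (h7.trans (abs_le.2 ⟨by linarith, h5⟩)) hc'
  · refine hηU _ (htail i _ (fun j hj => coord_sum_comp_of_ne hR.coord_e _ fun k hk h => ?_)
      (norm_coord_sum_comp_le hR.coord_e hninj fun k hk => ?_))
    · have h1 := (Finset.le_sup (f := tail) (Finset.mem_univ i)).trans
        ((le_max_right _ _).trans (hn₀n k hk))
      lia
    · have h1 := ((hlim k hk i).1 0 (Nat.zero_le _)).1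
      have hpos : 0 < weightProd w (lam k i) 1 (n k) :=
        weightProd_pos (hB.weight_pos _ (hlamI k hk i)) le_rfl
      rw [zero_add, zero_add, hvcoord, norm_pow] at h1
      rw [Complex.norm_real, Real.norm_of_nonneg (by positivity), one_div,
        ← Real.inv_rpow hpos.le, one_div, Real.rpow_inv_le_iff_of_pos (inv_pos.2 hpos).le
        (norm_nonneg _) (by exact_mod_cast hm), Real.rpow_natCast, inv_le_iff_one_le_mul₀' hpos]
      linarith
  · intro k hk i l hl
    rw [Finset.mem_Icc] at hk
    set T := Finset.Icc (k + 1) S.card with hT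
    have hTm : ∀ j ∈ T, j ∈ Finset.Icc 1 S.card ∧ n k + N < n j := fun j hj => by
      rw [hT, Finset.mem_Icc] at hj
      exact ⟨Finset.mem_Icc.2 ⟨by lia, hj.2⟩, hgap k j hk.1 (by lia) hj.2⟩
    have hinj : InjOn (fun j => n j - n k + l) T := fun j hj j' hj' h => by
      have h1 := hTm j hj
      have h2 := hTm j' hj'
      exact hninj h1.1 h2.1 (by simp only at h; lia)
    refine hηU _ (lt_of_le_of_lt (hR.solid q₀ _ (∑ l' ∈ T.image fun j => n j - n k + l,
      ((weightProd w (lam k i) (l' + 1) (l' + n k) : ℂ) * coord (v i) (l' + n k)) • e l')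
      (norm_coord_sum_comp_le hR.coord_e hinj fun j hj => ?_))
      (((hlim k (Finset.mem_Icc.2 hk) i).2 _ fun l' hl' => ?_).trans_lt hδη))
    · obtain ⟨hj1, hj2⟩ := hTm j hj
      rw [coord_sum_smul hR.coord_e, if_pos (Finset.mem_image_of_mem _ hj)]
      have h1 := ((hlim j hj1 i).1 l hl).1
      rw [show n j - n k + l + n k = n j + l by lia, norm_mul, Complex.norm_real, Complex.norm_real]
      have p1 : 0 < weightProd w (lam k i) (n j - n k + l + 1) (n j + l) :=
        weightProd_pos (hB.weight_pos _ (hlamI k (Finset.mem_Icc.2 hk) i)) (by lia)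
      have p2 : 0 < weightProd w (lam j i) (l + 1) (n j + l) :=
        weightProd_pos (hB.weight_pos _ (hlamI j hj1 i)) (by lia)
      rw [Real.norm_of_nonneg (by positivity), Real.norm_of_nonneg p1.le, div_eq_mul_inv]
      refine mul_le_mul_of_nonneg_left ?_ p1.le
      rw [inv_le_iff_one_le_mul₀' p2]
      rw [show l + n j = n j + l by lia] at h1
      linarith
    · obtain ⟨j, hj, rfl⟩ := Finset.mem_image.1 hl'
      have := (hTm j hj).2
      lia

end Necessity

/-! ### From the covering condition to a perturbation with prescribed orbits -/

section Sufficiency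

variable {X : Type*} [NonUnitalCommRing X] [Module ℂ X] [UniformSpace X]
  {coord : X →ₙₐ[ℂ] (ℕ → ℂ)} {e : ℕ → X} {R : ℕ → Seminorm ℂ X}
  {w : ℕ → ℝ → ℝ} {I : Set ℝ} {B : ℝ → X →L[ℂ] X} {c κ : ℝ}

/-- Domination by a finite family of vectors with non-negative coordinates. -/
theorem IsSolidSystem.le_mul_sum (hR : IsSolidSystem coord e R) {ι : Type*} (q : ℕ) {x : X}
    {s : Finset ι} {y : ι → X} {M : ℝ} (hM : 0 ≤ M)
    (hy : ∀ i ∈ s, ∀ n, coord (y i) n = (‖coord (y i) n‖ : ℂ))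
    (h : ∀ n, ‖coord x n‖ ≠ 0 → ∃ i ∈ s, ‖coord x n‖ ≤ M * ‖coord (y i) n‖) :
    R q x ≤ M * ∑ i ∈ s, R q (y i) := by
  refine (hR.le_mul q (y := ∑ i ∈ s, y i) hM fun n => ?_).trans
    (mul_le_mul_of_nonneg_left (Finset.le_sum_of_subadditive (R q) (map_zero _).le
      (map_add_le_add _) _ _) hM)
  by_cases hn : ‖coord x n‖ = 0
  · rw [hn]; positivity
  · obtain ⟨i, hi, hle⟩ := h n hn
    refine hle.trans (mul_le_mul_of_nonneg_left ?_ hM)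
    have hsum : coord (∑ i ∈ s, y i) n = ((∑ i ∈ s, ‖coord (y i) n‖ : ℝ) : ℂ) := by
      rw [map_sum, Finset.sum_apply, Complex.ofReal_sum]
      exact Finset.sum_congr rfl fun i hi => hy i hi n
    rw [hsum, Complex.norm_real, Real.norm_of_nonneg (by positivity)]
    exact Finset.single_le_sum (f := fun i => ‖coord (y i) n‖) (fun _ _ => norm_nonneg _) hi

/-- The scalar inequality behind `exists_nhds_shifted_sum_lt`: the product of weights over `[1, n_k]` is
split into its first factors `Y₀`, its middle part `Y₁` and its last factors `Y₂`. -/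
theorem one_div_rpow_le {p D κ' k Y₀ Y₁ Y₂ Yb : ℝ} (hp0 : 0 ≤ p) (hp1 : p ≤ 1) (hκ : 0 < κ')
    (hk : 0 < k) (h0 : 0 < Y₀) (h1 : 0 < Y₁) (hD : Y₀ ≤ D) (hY : κ' ≤ Y₂) (hb : k * Y₂ ≤ Yb) :
    1 / Y₁ ^ p ≤ D ^ p * κ' ^ (p - 1) / k * (Yb * (1 / (Y₀ * Y₁ * Y₂) ^ p)) := by
  have h2 : 0 < Y₂ := hκ.trans_le hY
  have key : Y₀ ^ p * Y₂ ^ p ≤ D ^ p * κ' ^ (p - 1) / k * Yb := by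
    have e1 : Y₂ ^ p = Y₂ ^ (p - 1) * Y₂ := by
      rw [Real.rpow_sub_one h2.ne', div_mul_cancel₀ _ h2.ne']
    calc Y₀ ^ p * Y₂ ^ p = Y₀ ^ p * Y₂ ^ (p - 1) * Y₂ := by rw [e1, mul_assoc]
      _ ≤ D ^ p * κ' ^ (p - 1) * (Yb / k) := by
          have i1 := Real.rpow_le_rpow h0.le hD hp0
          have i2 := Real.rpow_le_rpow_of_nonpos hκ hY (by linarith : p - 1 ≤ 0)
          have i3 : Y₂ ≤ Yb / k := (le_div_iff₀' hk).2 hb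
          have hD0 := h0.trans_le hD
          gcongr
      _ = _ := by ring
  rw [Real.mul_rpow (by positivity) h2.le, Real.mul_rpow h0.le h1.le]
  have p0 := Real.rpow_pos_of_pos h0 p
  have p1 := Real.rpow_pos_of_pos h1 p
  have p2 := Real.rpow_pos_of_pos h2 p
  rw [← mul_assoc, mul_one_div, div_le_div_iff₀ p1 (by positivity), one_mul]
  calc Y₀ ^ p * Y₁ ^ p * Y₂ ^ p = (Y₀ ^ p * Y₂ ^ p) * Y₁ ^ p := by ring
    _ ≤ _ := by gcongr

/-- Moving the basis vectors `N₀ - l` steps to the left preserves smallness: this is continuity of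
`B b`, up to constants that come from the bound below on the weights and their quotients. -/
theorem exists_nhds_shifted_sum_lt (hB : IsShiftFamily coord I w B c)
    (hR : IsSolidSystem coord e R) (hκ : 0 < κ) (hwκ : ∀ n, 1 ≤ n → ∀ a ∈ I, κ ≤ w n a)
    (hI : I.Nonempty) {m : ℕ} (hm : 1 ≤ m) {N₀ l : ℕ} (hl : l ≤ N₀) (q : ℕ) {η : ℝ} (hη : 0 < η) :
    ∃ U ∈ 𝓝 (0 : X), ∀ (T : Finset ℕ) (n : ℕ → ℕ) (a : ℕ → ℝ), InjOn n T →
      (∀ k ∈ T, N₀ ≤ n k) → (∀ k ∈ T, a k ∈ I) →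
      ∑ k ∈ T, ((1 / weightProd w (a k) 1 (n k) ^ (1 / (m : ℝ)) : ℝ) : ℂ) • e (n k) ∈ U →
      R q (∑ k ∈ T, ((1 / weightProd w (a k) (l + 1) (n k - N₀ + l) ^ (1 / (m : ℝ)) : ℝ) : ℂ) •
        e (n k - N₀ + l)) < η := by
  obtain ⟨b, hb⟩ := hI
  have hc := hB.ratio_pos
  set r := N₀ - l with hr
  -- The constant collects the first `l` weights, the passage from `Y ^ (1 / m)` to `Y` for the last
  -- `r` weights, and the change of parameter from `a k` to `b` in these.
  set M : ℝ := (weightProd w b 1 l / c ^ l) ^ (1 / (m : ℝ)) *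
    (κ ^ r) ^ (1 / (m : ℝ) - 1) / c ^ r with hM
  have hM0 : 0 < M := by
    have := weightProd_pos (hB.weight_pos b hb) (le_refl 1) (j := l)
    positivity
  refine ⟨{h | R q ((B b)^[r] h) < η / M}, (isOpen_lt ((hR.continuous q).comp
    ((B b).continuous.iterate r)) continuous_const).mem_nhds ?_,
    fun T n a hn hN₀ ha hU => ?_⟩
  · rw [mem_ofPred_eq, Function.comp_apply, iterate_map_zero, map_zero]
    positivity
  have hninj : InjOn (fun k => n k - N₀ + l) T := fun j hj k hk h => by
    have h1 := hN₀ j hj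
    have h2 := hN₀ k hk
    exact hn hj hk (by simp only at h; lia)
  rw [mem_ofPred_eq, lt_div_iff₀' hM0] at hU
  refine (hR.le_mul q hM0.le fun j => ?_).trans_lt hU
  by_cases hj : ∃ k ∈ T, n k - N₀ + l = j
  · obtain ⟨k, hk, rfl⟩ := hj
    have h1 := hN₀ k hk
    rw [coord_sum_comp_of_mem hR.coord_e hninj _ hk, hB.norm_coord_iterate hb,
      show n k - N₀ + l + r = n k by lia, coord_sum_comp_of_mem hR.coord_e hn _ hk]
    have p0 : 0 < weightProd w (a k) 1 l := weightProd_pos (hB.weight_pos _ (ha k hk)) le_rfl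
    have p1 : 0 < weightProd w (a k) (l + 1) (n k - N₀ + l) :=
      weightProd_pos (hB.weight_pos _ (ha k hk)) (by lia)
    have p2 : 0 < weightProd w (a k) 1 (n k) :=
      weightProd_pos (hB.weight_pos _ (ha k hk)) le_rfl
    rw [Complex.norm_real, Complex.norm_real, Real.norm_of_nonneg (by positivity),
      Real.norm_of_nonneg (by positivity),
      ← weightProd_mul_weightProd w (a k) (show 1 ≤ n k - N₀ + l + 1 by lia)
        (show n k - N₀ + l ≤ n k by lia),
      ← weightProd_mul_weightProd w (a k) (show 1 ≤ l + 1 by lia)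
        (show l ≤ n k - N₀ + l by lia)]
    refine one_div_rpow_le (by positivity) ?_ (by positivity) (by positivity) p0 p1 ?_ ?_ ?_
    · rw [one_div]
      exact inv_le_one_of_one_le₀ (by exact_mod_cast hm)
    · rw [le_div_iff₀' (by positivity)]
      exact hB.pow_mul_weightProd_le hb (ha k hk) le_rfl
    · have hcard : r = (Finset.Icc (n k - N₀ + l + 1) (n k)).card := by
        rw [Nat.card_Icc]; lia
      rw [hcard, weightProd, ← Finset.prod_const]
      exact Finset.prod_le_prod (fun _ _ => hκ.le) fun s hs =>
        hwκ s (by rw [Finset.mem_Icc] at hs; lia) _ (ha k hk)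
    · have := hB.pow_mul_weightProd_le hb (ha k hk) (show 1 ≤ n k - N₀ + l + 1 by lia) (j := n k)
      rwa [show n k + 1 - (n k - N₀ + l + 1) = r by lia] at this
  · push Not at hj
    rw [coord_sum_comp_of_ne hR.coord_e _ hj, norm_zero]
    positivity

theorem weightProd_mono (hB : IsShiftFamily coord I w B c) (hmono : ∀ n, 1 ≤ n → MonotoneOn (w n) I)
    {a b : ℝ} (ha : a ∈ I) (hb : b ∈ I) (hab : a ≤ b) {i j : ℕ} (hi : 1 ≤ i) :
    weightProd w a i j ≤ weightProd w b i j :=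
  Finset.prod_le_prod
    (fun k hk => (hB.weight_pos a ha k (hi.trans (Finset.mem_Icc.1 hk).1)).le)
    fun k hk => hmono k (hi.trans (Finset.mem_Icc.1 hk).1) ha hb hab

/-- On a tagged interval, the products of consecutive weights with indices at most `n` are
nearly constant. -/
theorem abs_weightProd_div_sub_one_le (hB : IsShiftFamily coord I w B c)
    (hmono : ∀ n, 1 ≤ n → MonotoneOn (w n) I) {F : ℕ → ℝ} (hF : Monotone F) {C τ : ℝ} (hC : 0 < C)
    (hf : ∀ n, 1 ≤ n → ∀ a ∈ I, ∀ b ∈ I, |logSum w n a - logSum w n b| ≤ C * F n * |b - a|)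
    {a b : ℝ} (ha : a ∈ I) (hb : b ∈ I) {n p l : ℕ} (hab : a ∈ tagInterval τ (F n) b)
    (hτ : 0 < τ) (hlp : l ≤ p) (hpn : p ≤ n) :
    |weightProd w a (l + 1) p / weightProd w b (l + 1) p - 1| ≤ 2 * C * τ := by
  obtain ⟨hle, hFτ⟩ := hab
  have key : ∀ s, s ≤ n → |logSum w s a - logSum w s b| ≤ C * τ := by
    intro s hs
    rcases Nat.eq_zero_or_pos s with rfl | hs0
    · simp only [logSum, Finset.Icc_eq_empty (show ¬ 1 ≤ 0 by lia), Finset.sum_empty, sub_zero,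
        abs_zero]
      positivity
    · refine (hf s hs0 a ha b hb).trans ?_
      rw [abs_of_nonneg (sub_nonneg.2 hle), mul_assoc]
      exact mul_le_mul_of_nonneg_left ((mul_le_mul_of_nonneg_right (hF hs)
        (sub_nonneg.2 hle)).trans hFτ) hC.le
  have hpos : 0 < weightProd w b (l + 1) p := weightProd_pos (hB.weight_pos b hb) (by lia)
  rw [abs_sub_comm, abs_of_nonneg (sub_nonneg.2 ((div_le_one hpos).2
    (weightProd_mono hB hmono ha hb hle (by lia)))), weightProd_eq_exp (hB.weight_pos a ha) hlp,
    weightProd_eq_exp (hB.weight_pos b hb) hlp, ← Real.exp_sub]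
  have h1 := Real.add_one_le_exp (logSum w p a - logSum w l a - (logSum w p b - logSum w l b))
  have h2 := abs_le.1 (key p hpn)
  have h3 := abs_le.1 (key l (hlp.trans hpn))
  linarith [h2.1, h3.2]

end Sufficiency

section Sufficiency

variable {X : Type*} [NonUnitalCommRing X] [Module ℂ X] [UniformSpace X]
  {coord : X →ₙₐ[ℂ] (ℕ → ℂ)} {e : ℕ → X} {R : ℕ → Seminorm ℂ X}
  {w : ℕ → ℝ → ℝ} {I : Set ℝ} {B : ℝ → X →L[ℂ] X} {c κ : ℝ}

/-- If the coordinates of `u` on the block `[n_k - N₀, n_k]` are `m`-th roots of those of `v` divided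
by products of weights, then the `(n_k - N₀)`-th iterate of the shift moves every vector `y` which
coincides with `u ^ m` up to higher powers close to `v`. The coordinates up to `N₀` of the difference
come from the block `k`, the other ones from the later blocks. -/
theorem seminorm_iterate_sub_le (hB : IsShiftFamily coord I w B c) (hR : IsSolidSystem coord e R)
    (hmono : ∀ n, 1 ≤ n → MonotoneOn (w n) I) {F : ℕ → ℝ} (hF : Monotone F) {C τ : ℝ} (hC : 0 < C)
    (hf : ∀ n, 1 ≤ n → ∀ a ∈ I, ∀ b ∈ I, |logSum w n a - logSum w n b| ≤ C * F n * |b - a|)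
    (hτ : 0 < τ) {N₀ s m q : ℕ} {n : ℕ → ℕ} {a : ℕ → ℝ}
    (hn : ∀ k ∈ Finset.Icc 1 s, 2 * N₀ + 1 ≤ n k)
    (hgap : ∀ j k, 1 ≤ j → j < k → k ≤ s → n j + (2 * N₀ + 1) ≤ n k)
    (ha : ∀ k ∈ Finset.Icc 1 s, a k ∈ I) {u v y : X} (hv : ∀ j, N₀ < j → coord v j = 0)
    (hu : ∀ k ∈ Finset.Icc 1 s, ∀ l ≤ N₀, coord u (n k - N₀ + l) ^ m =
      coord v l / weightProd w (a k) (l + 1) (n k - N₀ + l))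
    (hu0 : ∀ j, N₀ < j → (∀ k ∈ Finset.Icc 1 s, ∀ l ≤ N₀, n k - N₀ + l ≠ j) → coord u j = 0)
    {θ S : ℝ} (hθ1 : θ ≤ 1) (hS : 0 ≤ S) (huθ : ∀ j, N₀ < j → ‖coord u j‖ ≤ θ) (hm : 1 ≤ m)
    (hy : ∀ j, ‖coord u j‖ ≤ 1 → ‖coord y j - coord u j ^ m‖ ≤ S * ‖coord u j‖ ^ (m + 1))
    {k : ℕ} (hk : k ∈ Finset.Icc 1 s) {lam : ℝ} (hlam : lam ∈ I)
    (hlamk : lam ∈ tagInterval τ (F (n k)) (a k)) :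
    R q ((B lam)^[n k - N₀] y - v) ≤ (S * θ + 2 * C * τ) * R q v +
      (1 + S) * R q v / c ^ N₀ * ∑ l ∈ Finset.range (N₀ + 1),
        R q (∑ j ∈ Finset.Icc (k + 1) s,
          ((weightProd w (a k) (n j - n k + l + 1) (n j + l) /
            weightProd w (a j) (l + 1) (n j + l) : ℝ) : ℂ) • e (n j - n k + l)) := by
  have hc := hB.ratio_pos
  have hak := ha k hk
  have hnk := hn k hk
  have hk' := Finset.mem_Icc.1 hk
  have hθ0 : 0 ≤ θ := (norm_nonneg _).trans (huθ (N₀ + 1) (by lia))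
  set z := (B lam)^[n k - N₀] y - v with hz
  -- `z₁` is the part of the difference on the coordinates `0, …, N₀`.
  set z₁ := ∑ j ∈ Finset.range (N₀ + 1), coord z j • e j with hz₁
  have hzsplit : z = z₁ + (z - z₁) := by abel
  have hz₁c : ∀ j, coord z₁ j = if j ≤ N₀ then coord z j else 0 := fun j => by
    rw [hz₁, coord_sum_smul hR.coord_e]
    simp
  have hyu : ∀ j, N₀ < j → ‖coord y j‖ ≤ (1 + S) * ‖coord u j‖ ^ m := by
    intro j hj
    have h1 := huθ j hj
    have h2 := hy j (h1.trans hθ1)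
    have h3 := norm_le_norm_add_norm_sub (coord u j ^ m) (coord y j)
    rw [norm_sub_rev, norm_pow] at h3
    have h4 : ‖coord u j‖ ^ (m + 1) ≤ ‖coord u j‖ ^ m := by
      rw [pow_succ]
      exact mul_le_of_le_one_right (by positivity) (h1.trans hθ1)
    nlinarith
  rw [hzsplit]
  refine (map_add_le_add _ _ _).trans (add_le_add ?_ ?_)
  · refine hR.le_mul q (by positivity) fun j => ?_
    rw [hz₁c]
    split_ifs with hj
    · have hu' := hu k hk j hj
      have p1 : 0 < weightProd w lam (j + 1) (n k - N₀ + j) :=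
        weightProd_pos (hB.weight_pos _ hlam) (by lia)
      have p2 : 0 < weightProd w (a k) (j + 1) (n k - N₀ + j) :=
        weightProd_pos (hB.weight_pos _ hak) (by lia)
      have hratio := abs_weightProd_div_sub_one_le hB hmono hF hC hf hlam hak hlamk hτ
        (show j ≤ n k - N₀ + j by lia) (show n k - N₀ + j ≤ n k by lia)
      have hratio1 : weightProd w lam (j + 1) (n k - N₀ + j) /
          weightProd w (a k) (j + 1) (n k - N₀ + j) ≤ 1 :=
        (div_le_one p2).2 (weightProd_mono hB hmono hlam hak hlamk.1 (by lia))
      have huj := huθ (n k - N₀ + j) (by lia)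
      have hyj := hy (n k - N₀ + j) (huj.trans hθ1)
      have hunorm : ‖coord u (n k - N₀ + j)‖ ^ m =
          ‖coord v j‖ / weightProd w (a k) (j + 1) (n k - N₀ + j) := by
        rw [← norm_pow, hu', norm_div, Complex.norm_real, Real.norm_of_nonneg p2.le]
      rw [hz, map_sub, Pi.sub_apply, hB.coord_iterate hlam, add_comm j (n k - N₀)]
      set i := n k - N₀ + j
      set P := weightProd w lam (j + 1) i
      set Q := weightProd w (a k) (j + 1) i
      have hsplit : (P : ℂ) * coord y i - coord v j =
          (P : ℂ) * (coord y i - coord u i ^ m) + ((P / Q - 1 : ℝ) : ℂ) * coord v j := by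
        rw [hu']
        have : (Q : ℂ) ≠ 0 := by exact_mod_cast p2.ne'
        push_cast
        field_simp
        ring
      rw [hsplit, add_mul]
      refine (norm_add_le _ _).trans (add_le_add ?_ ?_)
      · rw [norm_mul, Complex.norm_real, Real.norm_of_nonneg p1.le]
        calc P * ‖coord y i - coord u i ^ m‖ ≤ P * (S * ‖coord u i‖ ^ (m + 1)) := by gcongr
          _ = S * ‖coord u i‖ * (P / Q) * ‖coord v j‖ := by
              rw [pow_succ, hunorm]; field_simp
          _ ≤ S * θ * 1 * ‖coord v j‖ := by gcongr
          _ = S * θ * ‖coord v j‖ := by ring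
      · rw [norm_mul, Complex.norm_real]
        exact mul_le_mul_of_nonneg_right hratio (norm_nonneg _)
    · rw [norm_zero]; positivity
  · have hinj : ∀ l, InjOn (fun j => n j - n k + l) (Finset.Icc (k + 1) s : Finset ℕ) := by
      intro l j hj j' hj' h
      rw [Finset.mem_coe, Finset.mem_Icc] at hj hj'
      have h1 := hgap k j hk'.1 (by lia) hj.2
      have h2 := hgap k j' hk'.1 (by lia) hj'.2
      rcases lt_trichotomy j j' with hlt | heq | hlt
      · have := hgap j j' (by lia) hlt hj'.2
        simp only at h; lia
      · exact heq
      · have := hgap j' j (by lia) hlt hj.2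
        simp only at h; lia
    have hcoef : ∀ l, ∀ j ∈ Finset.Icc (k + 1) s,
        0 ≤ weightProd w (a k) (n j - n k + l + 1) (n j + l) /
          weightProd w (a j) (l + 1) (n j + l) := by
      intro l j hj
      rw [Finset.mem_Icc] at hj
      exact div_nonneg (weightProd_pos (hB.weight_pos _ hak) (by lia)).le
        (weightProd_pos (hB.weight_pos _ (ha j (Finset.mem_Icc.2 ⟨by lia, hj.2⟩))) (by lia)).le
    refine hR.le_mul_sum q (by positivity) (fun l _ j => ?_) fun j hj => ?_
    · by_cases hj : ∃ t ∈ Finset.Icc (k + 1) s, n t - n k + l = j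
      · obtain ⟨t, ht, rfl⟩ := hj
        rw [coord_sum_comp_of_mem hR.coord_e (hinj l) _ ht, Complex.norm_real,
          Real.norm_of_nonneg (hcoef l t ht)]
      · push Not at hj
        rw [coord_sum_comp_of_ne hR.coord_e _ hj]
        simp
    · rw [map_sub, Pi.sub_apply, hz₁c] at hj ⊢
      split_ifs at hj ⊢ with hjN
      · simp at hj
      push Not at hjN
      rw [sub_zero, hz, map_sub, Pi.sub_apply, hv j hjN, sub_zero,
        hB.norm_coord_iterate hlam] at hj ⊢
      have huj : coord u (j + (n k - N₀)) ≠ 0 := by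
        intro h0
        have := hyu (j + (n k - N₀)) (by lia)
        rw [h0, norm_zero, zero_pow (by lia), mul_zero] at this
        rw [le_antisymm this (norm_nonneg _), mul_zero] at hj
        exact hj rfl
      obtain ⟨t, ht, l, hl, htl⟩ : ∃ t ∈ Finset.Icc 1 s, ∃ l ≤ N₀,
          n t - N₀ + l = j + (n k - N₀) := by
        by_contra! hcon
        exact huj (hu0 _ (by lia) hcon)
      have ht' := Finset.mem_Icc.1 ht
      have hkt : k < t := by
        rcases lt_trichotomy k t with hlt | rfl | hlt
        · exact hlt
        · lia
        · have := hgap t k ht'.1 hlt hk'.2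
          have := hn t ht
          lia
      have hgapkt := hgap k t hk'.1 hkt ht'.2
      have hj' : j = n t - n k + l := by lia
      have htm : t ∈ Finset.Icc (k + 1) s := Finset.mem_Icc.2 ⟨hkt, ht'.2⟩
      refine ⟨l, Finset.mem_range.2 (by lia), ?_⟩
      subst hj'
      rw [coord_sum_comp_of_mem hR.coord_e (hinj l) _ htm, Complex.norm_real,
        Real.norm_of_nonneg (hcoef l t htm), ← htl]
      have hat := ha t ht
      have p0 : 0 < weightProd w lam (n t - n k + l + 1) (n t - N₀ + l) :=
        weightProd_pos (hB.weight_pos _ hlam) (by lia)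
      have p1 : 0 < weightProd w (a k) (n t - n k + l + 1) (n t - N₀ + l) :=
        weightProd_pos (hB.weight_pos _ hak) (by lia)
      have p2 : 0 < weightProd w (a k) (n t - N₀ + l + 1) (n t + l) :=
        weightProd_pos (hB.weight_pos _ hak) (by lia)
      have p3 : 0 < weightProd w (a t) (l + 1) (n t - N₀ + l) :=
        weightProd_pos (hB.weight_pos _ hat) (by lia)
      have p4 : 0 < weightProd w (a t) (n t - N₀ + l + 1) (n t + l) :=
        weightProd_pos (hB.weight_pos _ hat) (by lia)
      have hle := weightProd_mono hB hmono hlam hak hlamk.1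
        (show 1 ≤ n t - n k + l + 1 by lia) (j := n t - N₀ + l)
      have hr := hB.pow_mul_weightProd_le hak hat (show 1 ≤ n t - N₀ + l + 1 by lia)
        (j := n t + l)
      rw [show n t + l + 1 - (n t - N₀ + l + 1) = N₀ by have := hn t ht; lia] at hr
      have hyt := hyu (n t - N₀ + l) (by lia)
      rw [← norm_pow, hu t ht l hl, norm_div, Complex.norm_real, Real.norm_of_nonneg p3.le] at hyt
      rw [← weightProd_mul_weightProd w (a k)
          (show n t - n k + l + 1 ≤ n t - N₀ + l + 1 by lia) (show n t - N₀ + l ≤ n t + l by lia),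
        ← weightProd_mul_weightProd w (a t) (show l + 1 ≤ n t - N₀ + l + 1 by lia)
          (show n t - N₀ + l ≤ n t + l by lia)]
      have hvl := hR.norm_coord_le q v l
      set P := weightProd w lam (n t - n k + l + 1) (n t - N₀ + l)
      set A1 := weightProd w (a k) (n t - n k + l + 1) (n t - N₀ + l)
      set A2 := weightProd w (a k) (n t - N₀ + l + 1) (n t + l)
      set A3 := weightProd w (a t) (l + 1) (n t - N₀ + l)
      set A4 := weightProd w (a t) (n t - N₀ + l + 1) (n t + l)
      have hcN : 0 < c ^ N₀ := by positivity
      have hone : 1 ≤ A2 / (c ^ N₀ * A4) := (one_le_div (by positivity)).2 hr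
      calc P * ‖coord y (n t - N₀ + l)‖ ≤ A1 * ((1 + S) * (R q v / A3)) := by
            refine mul_le_mul hle (hyt.trans ?_) (norm_nonneg _) p1.le
            gcongr
        _ = A1 * ((1 + S) * (R q v / A3)) * 1 := by ring
        _ ≤ A1 * ((1 + S) * (R q v / A3)) * (A2 / (c ^ N₀ * A4)) := by
            gcongr
        _ = _ := by field_simp

end Sufficiency

section Sufficiency

variable {X : Type*} [NonUnitalCommRing X] [Module ℂ X]
  {coord : X →ₙₐ[ℂ] (ℕ → ℂ)} {e : ℕ → X} {w : ℕ → ℝ → ℝ}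

/-- The vector carrying the values `ζ_l / (w_{l+1}(a_k) ⋯ w_{n_k - N₀ + l}(a_k))^{1/m}`, `l ≤ N₀`, on
the block `[n_k - N₀, n_k]`, for `k = 1, …, s`. -/
noncomputable def blockSum (e : ℕ → X) (w : ℕ → ℝ → ℝ) (m N₀ s : ℕ) (n : ℕ → ℕ) (a : ℕ → ℝ)
    (ζ : ℕ → ℂ) : X :=
  ∑ l ∈ Finset.range (N₀ + 1), ζ l • ∑ k ∈ Finset.Icc 1 s,
    ((1 / weightProd w (a k) (l + 1) (n k - N₀ + l) ^ (1 / (m : ℝ)) : ℝ) : ℂ) • e (n k - N₀ + l)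

theorem block_injective {N₀ s : ℕ} {n : ℕ → ℕ} (hn : ∀ k ∈ Finset.Icc 1 s, 2 * N₀ + 1 ≤ n k)
    (hgap : ∀ j k, 1 ≤ j → j < k → k ≤ s → n j + (2 * N₀ + 1) ≤ n k) {k k' l l' : ℕ}
    (hk : k ∈ Finset.Icc 1 s) (hk' : k' ∈ Finset.Icc 1 s) (hl : l ≤ N₀) (hl' : l' ≤ N₀)
    (h : n k - N₀ + l = n k' - N₀ + l') : k = k' ∧ l = l' := by
  have h1 := hn k hk
  have h2 := hn k' hk'
  rw [Finset.mem_Icc] at hk hk'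
  rcases lt_trichotomy k k' with hlt | rfl | hlt
  · have := hgap k k' hk.1 hlt hk'.2
    lia
  · exact ⟨rfl, by lia⟩
  · have := hgap k' k hk'.1 hlt hk.2
    lia

theorem coord_blockSum (he : ∀ n, coord (e n) = Pi.single n 1) {m N₀ s : ℕ} {n : ℕ → ℕ} {a : ℕ → ℝ}
    {ζ : ℕ → ℂ} (hn : ∀ k ∈ Finset.Icc 1 s, 2 * N₀ + 1 ≤ n k)
    (hgap : ∀ j k, 1 ≤ j → j < k → k ≤ s → n j + (2 * N₀ + 1) ≤ n k) {k l : ℕ}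
    (hk : k ∈ Finset.Icc 1 s) (hl : l ≤ N₀) :
    coord (blockSum e w m N₀ s n a ζ) (n k - N₀ + l) = ζ l *
      ((1 / weightProd w (a k) (l + 1) (n k - N₀ + l) ^ (1 / (m : ℝ)) : ℝ) : ℂ) := by
  have hinj : InjOn (fun k => n k - N₀ + l) (Finset.Icc 1 s : Finset ℕ) := fun j hj j' hj' h =>
    (block_injective hn hgap hj hj' hl hl h).1
  simp only [blockSum, map_sum _ _ (Finset.range (N₀ + 1)), map_smul coord (ζ _), Finset.sum_apply,
    Pi.smul_apply]
  rw [Finset.sum_eq_single_of_mem l (Finset.mem_range.2 (by lia)) fun l' hl' hne => ?_,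
    coord_sum_comp_of_mem he hinj _ hk, smul_eq_mul]
  rw [Finset.mem_range] at hl'
  rw [coord_sum_comp_of_ne he _ fun k' hk' h => hne
    (block_injective hn hgap hk' hk (by lia) hl h).2, smul_zero]

theorem coord_blockSum_of_ne (he : ∀ n, coord (e n) = Pi.single n 1) {m N₀ s : ℕ} {n : ℕ → ℕ}
    {a : ℕ → ℝ} {ζ : ℕ → ℂ} {j : ℕ}
    (hj : ∀ k ∈ Finset.Icc 1 s, ∀ l ≤ N₀, n k - N₀ + l ≠ j) :
    coord (blockSum e w m N₀ s n a ζ) j = 0 := by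
  simp only [blockSum, map_sum _ _ (Finset.range (N₀ + 1)), map_smul coord (ζ _), Finset.sum_apply,
    Pi.smul_apply]
  refine Finset.sum_eq_zero fun l hl => ?_
  rw [Finset.mem_range] at hl
  rw [coord_sum_comp_of_ne he _ fun k hk => hj k hk l (by lia), smul_zero]

variable [UniformSpace X] {R : ℕ → Seminorm ℂ X} {I : Set ℝ} {B : ℝ → X →L[ℂ] X} {c κ : ℝ}

/-- Near a finitely supported vector there is one whose power `u ^ m`, perturbed by any terms of
higher order in `u`, is brought close to a given finitely supported vector by an iterate of each
operator with parameter in `K`. -/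
theorem exists_perturbation (hB : IsShiftFamily coord I w B c) (hR : IsSolidSystem coord e R)
    (hκ : 0 < κ) (hwκ : ∀ n, 1 ≤ n → ∀ a ∈ I, κ ≤ w n a) (hI : I.Nonempty)
    (hmono : ∀ n, 1 ≤ n → MonotoneOn (w n) I) {F : ℕ → ℝ} (hF : Monotone F) {C : ℝ} (hC : 0 < C)
    (hf : ∀ n, 1 ≤ n → ∀ a ∈ I, ∀ b ∈ I, |logSum w n a - logSum w n b| ≤ C * F n * |b - a|)
    {d : ℕ} {Λ : Set (Fin d → ℝ)} (hΛI : ∀ lam ∈ Λ, ∀ i, lam i ∈ I) {m : ℕ} (hm : 1 ≤ m)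
    (hcover : CoverCondition e I w F Λ m) {N₀ : ℕ} {u₀ v : Fin d → X}
    (hu₀ : ∀ i j, N₀ < j → coord (u₀ i) j = 0) (hv : ∀ i j, N₀ < j → coord (v i) j = 0)
    {K : Set (Fin d → ℝ)} (hKΛ : K ⊆ Λ) (hK : IsCompact K) {S : ℝ} (hS : 0 ≤ S) (q : ℕ) {η : ℝ}
    (hη : 0 < η) :
    ∃ u : Fin d → X, (∀ i, R q (u i - u₀ i) < η) ∧ ∀ lam ∈ K, ∃ n, 1 ≤ n ∧ ∀ y : Fin d → X,
      (∀ i j, ‖coord (u i) j‖ ≤ 1 →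
        ‖coord (y i) j - coord (u i) j ^ m‖ ≤ S * ‖coord (u i) j‖ ^ (m + 1)) →
      ∀ i, R q ((B (lam i))^[n] (y i) - v i) < η := by
  have hc := hB.ratio_pos
  choose ζ hζ using fun i l => IsAlgClosed.exists_pow_nat_eq (coord (v i) l)
    (show 0 < m by lia)
  set V := ∑ i, R q (v i) with hV
  have hVi : ∀ i, R q (v i) ≤ V := fun i =>
    Finset.single_le_sum (f := fun i => R q (v i)) (fun _ _ => apply_nonneg _ _) (Finset.mem_univ i)
  have hV0 : 0 ≤ V := Finset.sum_nonneg fun _ _ => apply_nonneg _ _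
  obtain ⟨θ', hθ'0, hθ'⟩ := exists_pos_mul_lt (show 0 < η / 4 by positivity) (S * V)
  obtain ⟨τ, hτ0, hτ⟩ := exists_pos_mul_lt (show 0 < η / 4 by positivity) (2 * C * V)
  obtain ⟨ε, hε0, hε⟩ := exists_pos_mul_lt (show 0 < η / 4 by positivity)
    ((1 + S) * V / c ^ N₀ * (N₀ + 1))
  set θ := min θ' 1 with hθ
  set Z := ∑ i, ∑ l ∈ Finset.range (N₀ + 1), ‖ζ i l‖ with hZ
  have hZi : ∀ i, ∑ l ∈ Finset.range (N₀ + 1), ‖ζ i l‖ ≤ Z := fun i =>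
    Finset.single_le_sum (f := fun i => ∑ l ∈ Finset.range (N₀ + 1), ‖ζ i l‖)
      (fun _ _ => by positivity) (Finset.mem_univ i)
  obtain ⟨ε', hε'0, hε'⟩ := exists_pos_mul_lt (show 0 < min η θ by positivity) Z
  have hU : ∀ l : Fin (N₀ + 1), ∃ U ∈ 𝓝 (0 : X), ∀ (T : Finset ℕ) (n : ℕ → ℕ) (a : ℕ → ℝ),
      InjOn n T → (∀ k ∈ T, N₀ ≤ n k) → (∀ k ∈ T, a k ∈ I) →
      ∑ k ∈ T, ((1 / weightProd w (a k) 1 (n k) ^ (1 / (m : ℝ)) : ℝ) : ℂ) • e (n k) ∈ U →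
      R q (∑ k ∈ T, ((1 / weightProd w (a k) (l + 1) (n k - N₀ + l) ^ (1 / (m : ℝ)) : ℝ) : ℂ) •
        e (n k - N₀ + l)) < ε' := fun l =>
    exists_nhds_shifted_sum_lt hB hR hκ hwκ hI hm (by lia) q hε'0
  choose U hU0 hU using hU
  obtain ⟨s, n, a, hn1, hgap1, ha, hcov, hsmall, htail⟩ := hcover τ hτ0 (2 * N₀ + 1) (by lia)
    ((⋂ l, U l) ∩ {x | R q x < ε})
    (inter_mem (iInter_mem.2 hU0) (seminorm_lt_mem_nhds (hR.continuous q) hε0)) K hKΛ hK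
  have hgap : ∀ j k, 1 ≤ j → j < k → k ≤ s → n j + (2 * N₀ + 1) ≤ n k := by
    intro j k hj hjk
    induction k, hjk using Nat.le_induction with
    | base => exact fun h => hgap1 j hj (by lia)
    | succ k hk ih =>
      intro h
      have := ih (by lia)
      have := hgap1 k (by lia) (by lia)
      lia
  have hn : ∀ k ∈ Finset.Icc 1 s, 2 * N₀ + 1 ≤ n k := by
    intro k hk
    rw [Finset.mem_Icc] at hk
    rcases hk.1.eq_or_lt with rfl | h1
    · exact hn1 hk.2
    · have := hgap 1 k le_rfl h1 hk.2
      lia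
  have hninj : InjOn n (Finset.Icc 1 s : Finset ℕ) := fun j hj k hk h =>
    (block_injective hn hgap (l := 0) (l' := 0) hj hk (by lia) (by lia) (by rw [h])).1
  set g : Fin d → X := fun i => blockSum e w m N₀ s n (fun k => a k i) (ζ i) with hg
  have hgq : ∀ i, R q (g i) < min η θ := by
    intro i
    refine lt_of_le_of_lt ?_ hε'
    refine (Finset.le_sum_of_subadditive (R q) (map_zero _).le (map_add_le_add _) _ _).trans ?_
    refine le_trans ?_ (mul_le_mul_of_nonneg_right (hZi i) hε'0.le)
    rw [Finset.sum_mul]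
    refine Finset.sum_le_sum fun l hl => ?_
    rw [map_smul_eq_mul]
    refine mul_le_mul_of_nonneg_left (le_of_lt ?_) (norm_nonneg _)
    exact hU ⟨l, Finset.mem_range.1 hl⟩ _ n (fun k => a k i) hninj
      (fun k hk => by have := hn k hk; lia) (fun k hk => ha k hk i)
      (mem_iInter.1 (hsmall i).1 _)
  have hug : ∀ i j, N₀ < j → coord (u₀ i + g i) j = coord (g i) j := fun i j hj => by
    rw [map_add, Pi.add_apply, hu₀ i j hj, zero_add]
  refine ⟨fun i => u₀ i + g i, fun i => ?_, fun lam hlam => ?_⟩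
  · rw [add_sub_cancel_left]
    exact (hgq i).trans_le (min_le_left _ _)
  · obtain ⟨k, hk, hlamk⟩ := mem_iUnion₂.1 (hcov hlam)
    refine ⟨n k - N₀, by have := hn k hk; lia, fun y hy i => ?_⟩
    have h := seminorm_iterate_sub_le hB hR hmono hF hC hf hτ0 hn hgap (q := q)
      (fun k hk => ha k hk i) (hv i) (u := u₀ i + g i) (m := m) (fun k hk l hl => ?_)
      (fun j hj hj0 => ?_) (min_le_right θ' 1) hS (fun j hj => ?_) hm (hy i) hk
      (hΛI lam (hKΛ hlam) i) (hlamk i (mem_univ i))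
    · refine h.trans_lt ?_
      have h1 : ∑ l ∈ Finset.range (N₀ + 1), R q (∑ j ∈ Finset.Icc (k + 1) s,
          ((weightProd w (a k i) (n j - n k + l + 1) (n j + l) /
            weightProd w (a j i) (l + 1) (n j + l) : ℝ) : ℂ) • e (n j - n k + l)) ≤
          (N₀ + 1) * ε := by
        refine (Finset.sum_le_card_nsmul _ _ ε fun l hl => ?_).trans (by simp)
        rw [Finset.mem_range] at hl
        exact (htail k hk i l (by lia)).2.le
      have h2 : (S * θ + 2 * C * τ) * R q (v i) ≤ S * V * θ' + 2 * C * V * τ := by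
        calc (S * θ + 2 * C * τ) * R q (v i) ≤ (S * θ' + 2 * C * τ) * V := by
              gcongr
              · exact min_le_left _ _
              · exact hVi i
          _ = _ := by ring
      have h3 := mul_le_mul (div_le_div_of_nonneg_right (mul_le_mul_of_nonneg_left (hVi i)
        (show 0 ≤ 1 + S by linarith)) (pow_pos hc N₀).le) h1
        (Finset.sum_nonneg fun _ _ => apply_nonneg _ _) (by positivity)
      rw [mul_assoc ((1 + S) * V / c ^ N₀)] at hε
      linarith
    · have hk0 := hn k hk
      have hpos : 0 < weightProd w (a k i) (l + 1) (n k - N₀ + l) :=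
        weightProd_pos (hB.weight_pos _ (ha k hk i)) (by lia)
      rw [hug i _ (by lia), hg, coord_blockSum hR.coord_e hn hgap hk hl, mul_pow, hζ,
        ← Complex.ofReal_pow, div_pow, one_pow, ← Real.rpow_natCast, ← Real.rpow_mul hpos.le,
        one_div_mul_cancel (by positivity), Real.rpow_one, Complex.ofReal_div, Complex.ofReal_one,
        mul_one_div]
    · rw [hug i j hj]
      exact coord_blockSum_of_ne hR.coord_e hj0
    · rw [hug i j hj]
      exact (hR.norm_coord_le q _ j).trans ((hgq i).le.trans (min_le_right _ _))

end Sufficiency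

/-! ### The algebra generated by a generic vector -/

section Algebra

variable {X : Type*} [NonUnitalCommRing X] [Module ℂ X] {coord : X →ₙₐ[ℂ] (ℕ → ℂ)} {d : ℕ}

/-- The value at `u` of the polynomial `z ^ m + ∑_j a_j z ^ (m + 1 + j)`. -/
noncomputable def polyVec (m M : ℕ) (a : Fin M → ℂ) (u : Fin d → X) : Fin d → X :=
  algPow u m + ∑ j : Fin M, a j • algPow u (m + 1 + j)

theorem coord_polyVec (coord : X →ₙₐ[ℂ] (ℕ → ℂ)) {m M : ℕ} (hm : 1 ≤ m) (a : Fin M → ℂ)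
    (u : Fin d → X) (i : Fin d) (n : ℕ) :
    coord (polyVec m M a u i) n =
      coord (u i) n ^ m + ∑ j : Fin M, a j * coord (u i) n ^ (m + 1 + (j : ℕ)) := by
  simp only [polyVec, Pi.add_apply, Finset.sum_apply, Pi.smul_apply, map_add, map_sum, map_smul,
    algPow_apply, smul_eq_mul]
  rw [coord_algPow coord _ hm]
  congr 1
  exact Finset.sum_congr rfl fun j _ => by rw [coord_algPow coord _ (by lia)]

theorem norm_coord_polyVec_sub_le (coord : X →ₙₐ[ℂ] (ℕ → ℂ)) {m M : ℕ} (hm : 1 ≤ m) {s : ℝ}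
    {a : Fin M → ℂ} (ha : ∀ j, ‖a j‖ ≤ s) (u : Fin d → X) (i : Fin d) (n : ℕ)
    (hu : ‖coord (u i) n‖ ≤ 1) :
    ‖coord (polyVec m M a u i) n - coord (u i) n ^ m‖ ≤ M * s * ‖coord (u i) n‖ ^ (m + 1) := by
  rw [coord_polyVec coord hm, add_sub_cancel_left, mul_assoc]
  refine (norm_sum_le_of_le _ fun j _ => ?_).trans (b := ∑ j : Fin M,
    s * ‖coord (u i) n‖ ^ (m + 1)) (by simp)
  rw [norm_mul, norm_pow]
  exact mul_le_mul (ha j) (pow_le_pow_of_le_one (norm_nonneg _) hu (by lia)) (by positivity)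
    ((norm_nonneg _).trans (ha j))

/-- The algebra of all polynomials without constant term in `u`, described by coordinates. -/
def polySubalgebra (coord : X →ₙₐ[ℂ] (ℕ → ℂ)) (u : Fin d → X) :
    NonUnitalSubalgebra ℂ (Fin d → X) where
  carrier := {y | ∃ P : Polynomial ℂ, P.coeff 0 = 0 ∧
    ∀ i n, coord (y i) n = P.eval (coord (u i) n)}
  add_mem' := by
    rintro y z ⟨P, hP, hy⟩ ⟨Q, hQ, hz⟩
    exact ⟨P + Q, by simp [hP, hQ], fun i n => by simp [hy, hz]⟩
  zero_mem' := ⟨0, by simp, fun i n => by simp⟩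
  mul_mem' := by
    rintro y z ⟨P, hP, hy⟩ ⟨Q, hQ, hz⟩
    exact ⟨P * Q, by simp [hP, Polynomial.mul_coeff_zero], fun i n => by simp [hy, hz]⟩
  smul_mem' := by
    rintro a y ⟨P, hP, hy⟩
    exact ⟨Polynomial.C a * P, by simp [hP], fun i n => by simp [hy]⟩

theorem self_mem_polySubalgebra (coord : X →ₙₐ[ℂ] (ℕ → ℂ)) (u : Fin d → X) :
    u ∈ polySubalgebra coord u :=
  ⟨Polynomial.X, by simp, fun i n => by simp⟩

/-- Up to a non-zero factor, a non-zero polynomial in `u` has leading term `u ^ m` at `u = 0`. -/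
theorem exists_eq_smul_polyVec (hcoord : Function.Injective coord) {u y : Fin d → X}
    (hy : y ∈ polySubalgebra coord u) (hy0 : y ≠ 0) :
    ∃ (b : ℂ) (m M : ℕ) (a : Fin M → ℂ), b ≠ 0 ∧ 1 ≤ m ∧ y = b • polyVec m M a u := by
  obtain ⟨P, hP, hyP⟩ := hy
  have hP0 : P ≠ 0 := by
    rintro rfl
    exact hy0 (funext fun i => hcoord (funext fun n => by simp [hyP]))
  set m := P.natTrailingDegree with hm
  have hb : P.coeff m ≠ 0 := Polynomial.coeff_natTrailingDegree_ne_zero.2 hP0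
  have hm1 : 1 ≤ m := Nat.one_le_iff_ne_zero.2 fun h => hb (by rw [h, hP])
  refine ⟨P.coeff m, m, P.natDegree, fun j => P.coeff (m + 1 + j) / P.coeff m, hb, hm1,
    funext fun i => hcoord (funext fun n => ?_)⟩
  rw [hyP, Pi.smul_apply, map_smul, Pi.smul_apply, coord_polyVec coord hm1, smul_eq_mul, mul_add,
    Finset.mul_sum, Polynomial.eval_eq_sum_range' (show P.natDegree < m + 1 + P.natDegree by lia),
    Finset.sum_range_add, Finset.sum_range_succ, Finset.sum_eq_zero fun k hk => by
      rw [Polynomial.coeff_eq_zero_of_lt_natTrailingDegree (Finset.mem_range.1 hk), zero_mul],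
    zero_add, ← Fin.sum_univ_eq_sum_range fun k =>
      P.coeff (m + 1 + k) * coord (u i) n ^ (m + 1 + k)]
  congr 1
  refine Finset.sum_congr rfl fun j _ => ?_
  field_simp

theorem IsHypercyclicVector.smul [TopologicalSpace X] [ContinuousSMul ℂ X] {B : ℝ → X →L[ℂ] X}
    {lam : Fin d → ℝ} {y : Fin d → X} (h : IsHypercyclicVector (prodOp B lam) y) {b : ℂ}
    (hb : b ≠ 0) : IsHypercyclicVector (prodOp B lam) (b • y) := by
  have hsurj : Function.Surjective fun z : Fin d → X => b • z := fun z =>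
    ⟨b⁻¹ • z, smul_inv_smul₀ hb z⟩
  refine (hsurj.denseRange.dense_image (continuous_const_smul b) h).mono ?_
  rintro _ ⟨_, ⟨n, hn, rfl⟩, rfl⟩
  refine ⟨n, hn, funext fun i => ?_⟩
  simp only [Pi.smul_apply, iterate_prodOp]
  exact (Function.Commute.iterate_left (f := B (lam i)) (g := (b • ·))
    (fun x => map_smul (B (lam i)) b x) n (y i)).symm

end Algebra

section Topology

theorem exists_nhds_zero_forall_sub_mem {X : Type*} [AddCommGroup X] [TopologicalSpace X]
    [IsTopologicalAddGroup X] {d : ℕ} {U : Set (Fin d → X)} {u : Fin d → X} (hU : U ∈ 𝓝 u) :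
    ∃ V ∈ 𝓝 (0 : X), ∀ x : Fin d → X, (∀ i, x i - u i ∈ V) → x ∈ U := by
  rw [nhds_pi, Filter.mem_pi'] at hU
  obtain ⟨s, t, ht, hsub⟩ := hU
  refine ⟨⋂ i, (fun z => z + u i) ⁻¹' t i, Filter.iInter_mem.2 fun i => ?_, fun x hx => hsub ?_⟩
  · refine (continuous_id.add continuous_const).continuousAt.preimage_mem_nhds ?_
    simpa using ht i
  · intro i _
    simpa using mem_iInter.1 (hx i) i

variable {X : Type*} [NonUnitalCommRing X] [Module ℂ X] [UniformSpace X]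
  {coord : X →ₙₐ[ℂ] (ℕ → ℂ)} {p : ℕ → Seminorm ℂ X} {e : ℕ → X} {R : ℕ → Seminorm ℂ X} {d : ℕ}

/-- Every non-empty open set contains vectors of finite support, with supports in `[0, N]` for all
large `N`. -/
theorem IsSolidSystem.eventually_exists_mem (hR : IsSolidSystem coord e R)
    {U : Set (Fin d → X)} (hU : IsOpen U) (hne : U.Nonempty) :
    ∀ᶠ N in atTop, ∃ u ∈ U, ∀ i j, N < j → coord (u i) j = 0 := by
  obtain ⟨x, hx⟩ := hne
  have hlim : Tendsto (fun N i => ∑ n ∈ Finset.range N, coord (x i) n • e n) atTop (𝓝 x) :=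
    tendsto_pi_nhds.2 fun i => hR.tendsto_sum_range (x i)
  filter_upwards [hlim.eventually (hU.mem_nhds hx)] with N hN
  refine ⟨_, hN, fun i j hj => ?_⟩
  rw [coord_sum_smul hR.coord_e, if_neg (by rw [Finset.mem_range]; lia)]

variable [IsUniformAddGroup X]

theorem IsFrechetSequenceAlgebra.continuousMul (hX : IsFrechetSequenceAlgebra coord p) :
    ContinuousMul X := by
  refine ⟨continuous_iff_continuousAt.2 ?_⟩
  rintro ⟨x₀, y₀⟩
  rw [ContinuousAt, hX.withSeminorms.tendsto_nhds]
  intro q ε hε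
  have hp := hX.withSeminorms.continuous_seminorm q
  have hlim : Tendsto (fun z : X × X => p q (z.1 - x₀) * p q (z.2 - y₀) +
      p q (z.1 - x₀) * p q y₀ + p q x₀ * p q (z.2 - y₀)) (𝓝 (x₀, y₀)) (𝓝 0) := by
    have hcont : Continuous fun z : X × X => p q (z.1 - x₀) * p q (z.2 - y₀) +
        p q (z.1 - x₀) * p q y₀ + p q x₀ * p q (z.2 - y₀) := by
      have h1 : Continuous fun z : X × X => p q (z.1 - x₀) :=
        hp.comp (continuous_fst.sub continuous_const)
      have h2 : Continuous fun z : X × X => p q (z.2 - y₀) :=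
        hp.comp (continuous_snd.sub continuous_const)
      exact ((h1.mul h2).add (h1.mul continuous_const)).add (continuous_const.mul h2)
    simpa using hcont.tendsto (x₀, y₀)
  filter_upwards [hlim.eventually (Iio_mem_nhds hε)] with z hz
  refine lt_of_le_of_lt ?_ hz
  have hsplit : z.1 * z.2 - x₀ * y₀ =
      (z.1 - x₀) * (z.2 - y₀) + (z.1 - x₀) * y₀ + x₀ * (z.2 - y₀) := by
    simp only [sub_mul, mul_sub]; abel
  rw [hsplit]
  refine (map_add_le_add _ _ _).trans (add_le_add ((map_add_le_add _ _ _).trans (add_le_add ?_ ?_))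
    ?_) <;> exact hX.seminorm_mul_le q _ _

theorem continuous_algPow {Y : Type*} [TopologicalSpace Y] [Mul Y] [ContinuousMul Y] (m : ℕ) :
    Continuous fun u : Y => algPow u m := by
  match m with
  | 0 => exact continuous_id
  | 1 => exact continuous_id
  | m + 2 => exact (continuous_algPow (m + 1)).mul continuous_id

theorem continuous_polyVec [ContinuousSMul ℂ X] [ContinuousMul X] (m M : ℕ) :
    Continuous fun z : (Fin M → ℂ) × (Fin d → X) => polyVec m M z.1 z.2 := by
  unfold polyVec
  refine ((continuous_algPow m).comp continuous_snd).add (continuous_finsetSum _ fun j _ => ?_)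
  exact ((continuous_apply j).comp continuous_fst).smul ((continuous_algPow _).comp continuous_snd)

theorem IsSolidSystem.separableSpace (hR : IsSolidSystem coord e R) [ContinuousSMul ℂ X] :
    TopologicalSpace.SeparableSpace X := by
  rw [← TopologicalSpace.isSeparable_univ_iff]
  have h : TopologicalSpace.IsSeparable (closure (Submodule.span ℂ (range e) : Set X)) :=
    (TopologicalSpace.IsSeparable.span (countable_range e).isSeparable).closure
  convert h using 1
  refine (eq_univ_of_forall fun x => ?_).symm
  refine mem_closure_of_tendsto (hR.tendsto_sum_range x) (Eventually.of_forall fun N => ?_)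
  exact Submodule.sum_mem _ fun n _ => Submodule.smul_mem _ _ (Submodule.subset_span ⟨n, rfl⟩)

end Topology

section Baire

variable {X : Type*} [NonUnitalCommRing X] [Module ℂ X] [UniformSpace X] [IsUniformAddGroup X]
  {coord : X →ₙₐ[ℂ] (ℕ → ℂ)} {e : ℕ → X} {R : ℕ → Seminorm ℂ X} {d : ℕ}
  {w : ℕ → ℝ → ℝ} {I : Set ℝ} {B : ℝ → X →L[ℂ] X} {c κ : ℝ}

/-- The vectors `u` such that, for all `lam ∈ K` and all coefficients bounded by `s`, the orbit of
the corresponding polynomial in `u` visits `V`. -/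
def visitSet (B : ℝ → X →L[ℂ] X) (K : Set (Fin d → ℝ)) (m M s : ℕ) (V : Set (Fin d → X)) :
    Set (Fin d → X) :=
  {u | ∀ z ∈ K ×ˢ Metric.closedBall (0 : Fin M → ℂ) s,
    ∃ n, 1 ≤ n ∧ (prodOp B z.1)^[n] (polyVec m M z.2 u) ∈ V}

/-- By joint continuity and compactness of the set of parameters and coefficients. -/
theorem isOpen_visitSet (hB : IsShiftFamily coord I w B c) (hR : IsSolidSystem coord e R)
    [ContinuousSMul ℂ X] [ContinuousMul X] {K : Set (Fin d → ℝ)} (hK : IsCompact K)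
    (hKI : ∀ lam ∈ K, ∀ i, lam i ∈ I) (m M s : ℕ) {V : Set (Fin d → X)} (hV : IsOpen V) :
    IsOpen (visitSet B K m M s V) := by
  have : CompactSpace K := isCompact_iff_compactSpace.1 hK
  have : CompactSpace (Metric.closedBall (0 : Fin M → ℂ) s) :=
    isCompact_iff_compactSpace.1 (isCompact_closedBall _ _)
  have hcont : ∀ n, Continuous fun z : (Fin d → X) × (K × Metric.closedBall (0 : Fin M → ℂ) s) =>
      (prodOp B z.2.1.1)^[n] (polyVec m M z.2.2.1 z.1) := by
    intro n
    refine continuous_pi fun i => ?_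
    simp only [iterate_prodOp]
    have h1 : Continuous fun z : (Fin d → X) × (K × Metric.closedBall (0 : Fin M → ℂ) s) =>
        ((⟨z.2.1.1 i, hKI _ z.2.1.2 i⟩ : I), polyVec m M z.2.2.1 z.1 i) := by
      refine Continuous.prodMk (Continuous.subtype_mk ?_ _) ?_
      · exact (continuous_apply i).comp
          (continuous_subtype_val.comp (continuous_fst.comp continuous_snd))
      · exact (continuous_apply i).comp ((continuous_polyVec m M).comp
          ((continuous_subtype_val.comp (continuous_snd.comp continuous_snd)).prodMk
            continuous_fst))
    exact (hB.continuous_iterate hR n).comp h1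
  rw [isOpen_iff_mem_nhds]
  intro u hu
  have := isCompact_univ.eventually_forall_of_forall_eventually (x₀ := u)
    (P := fun x (z : K × Metric.closedBall (0 : Fin M → ℂ) s) =>
      ∃ n, 1 ≤ n ∧ (prodOp B z.1.1)^[n] (polyVec m M z.2.1 x) ∈ V) fun z _ => by
    obtain ⟨n, hn, h⟩ := hu (z.1.1, z.2.1) ⟨z.1.2, z.2.2⟩
    filter_upwards [(hcont n).continuousAt.preimage_mem_nhds (hV.mem_nhds h)] with x hx
    exact ⟨n, hn, hx⟩
  filter_upwards [this] with x hx z hz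
  exact hx (⟨z.1, hz.1⟩, ⟨z.2, hz.2⟩) (mem_univ _)

theorem dense_visitSet (hB : IsShiftFamily coord I w B c) (hR : IsSolidSystem coord e R)
    (hκ : 0 < κ) (hwκ : ∀ n, 1 ≤ n → ∀ a ∈ I, κ ≤ w n a) (hI : I.Nonempty)
    (hmono : ∀ n, 1 ≤ n → MonotoneOn (w n) I) {F : ℕ → ℝ} (hF : Monotone F) {C : ℝ} (hC : 0 < C)
    (hf : ∀ n, 1 ≤ n → ∀ a ∈ I, ∀ b ∈ I, |logSum w n a - logSum w n b| ≤ C * F n * |b - a|)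
    {Λ : Set (Fin d → ℝ)} (hΛI : ∀ lam ∈ Λ, ∀ i, lam i ∈ I) {m : ℕ} (hm : 1 ≤ m)
    (hcover : CoverCondition e I w F Λ m) {K : Set (Fin d → ℝ)} (hKΛ : K ⊆ Λ) (hK : IsCompact K)
    (M s : ℕ) {V : Set (Fin d → X)} (hV : IsOpen V) (hVne : V.Nonempty) :
    Dense (visitSet B K m M s V) := by
  rw [dense_iff_inter_open]
  intro U hU hUne
  obtain ⟨N₀, ⟨u₀, hu₀U, hu₀⟩, ⟨v, hvV, hv⟩⟩ :=
    ((hR.eventually_exists_mem hU hUne).and (hR.eventually_exists_mem hV hVne)).exists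
  obtain ⟨W, hW, hWU⟩ := exists_nhds_zero_forall_sub_mem (hU.mem_nhds hu₀U)
  obtain ⟨W', hW', hWV⟩ := exists_nhds_zero_forall_sub_mem (hV.mem_nhds hvV)
  obtain ⟨q, η, hη, hq⟩ := hR.exists_lt_imp_mem _ (inter_mem hW hW')
  obtain ⟨u, huu₀, hu⟩ := exists_perturbation hB hR hκ hwκ hI hmono hF hC hf hΛI hm hcover hu₀ hv
    hKΛ hK (S := M * s) (by positivity) q hη
  refine ⟨u, hWU u fun i => (hq _ (huu₀ i)).1, ?_⟩
  rintro ⟨lam, a⟩ ⟨hlam, ha⟩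
  obtain ⟨n, hn, h⟩ := hu lam hlam
  refine ⟨n, hn, hWV _ fun i => (hq _ ?_).2⟩
  rw [iterate_prodOp]
  refine h _ (fun i j hj => norm_coord_polyVec_sub_le coord hm (fun k => ?_) u i j hj) i
  exact (norm_le_pi_norm a k).trans (mem_closedBall_zero_iff.1 ha)

theorem hasCommonHypercyclicAlgebra_of_coverCondition (hB : IsShiftFamily coord I w B c)
    (hR : IsSolidSystem coord e R) [ContinuousSMul ℂ X] [ContinuousMul X] [T2Space X]
    [CompleteSpace X] [(uniformity X).IsCountablyGenerated]
    (hκ : 0 < κ) (hwκ : ∀ n, 1 ≤ n → ∀ a ∈ I, κ ≤ w n a) (hI : I.Nonempty)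
    (hmono : ∀ n, 1 ≤ n → MonotoneOn (w n) I) {F : ℕ → ℝ} (hF : Monotone F) {C : ℝ} (hC : 0 < C)
    (hf : ∀ n, 1 ≤ n → ∀ a ∈ I, ∀ b ∈ I, |logSum w n a - logSum w n b| ≤ C * F n * |b - a|)
    (hd : 1 ≤ d) {Λ : Set (Fin d → ℝ)} (hΛI : ∀ lam ∈ Λ, ∀ i, lam i ∈ I) (hΛ : IsSigmaCompact Λ)
    (hcover : ∀ m, 1 ≤ m → CoverCondition e I w F Λ m) :
    HasCommonHypercyclicAlgebra (prodOp (d := d) B) Λ := by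
  obtain ⟨K, hK, rfl⟩ := hΛ
  have : Nontrivial X := ⟨e 0, 0, fun h => by simpa [hR.coord_e] using congrFun (congrArg coord h) 0⟩
  have : Nonempty (Fin d) := ⟨⟨0, hd⟩⟩
  have hperf : (𝓝[≠] (0 : Fin d → X)).NeBot := Module.punctured_nhds_neBot ℂ _ 0
  have := hR.separableSpace
  have := UniformSpace.secondCountable_of_separable X
  set 𝓑 := TopologicalSpace.countableBasis (Fin d → X)
  have h𝓑 : TopologicalSpace.IsTopologicalBasis 𝓑 :=
    TopologicalSpace.isBasis_countableBasis (Fin d → X)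
  have hKΛ : ∀ r, K r ⊆ ⋃ r, K r := subset_iUnion K
  have : Countable 𝓑 := (TopologicalSpace.countable_countableBasis (Fin d → X)).to_subtype
  have hdense := dense_iInter_of_isOpen
    (f := fun z : ℕ × ℕ × ℕ × ℕ × 𝓑 => visitSet B (K z.1) (z.2.1 + 1) z.2.2.1 z.2.2.2.1 z.2.2.2.2)
    (fun z => isOpen_visitSet hB hR (hK _) (fun lam h => hΛI lam (hKΛ _ h)) _ _ _
      (h𝓑.isOpen z.2.2.2.2.2))
    fun z => dense_visitSet hB hR hκ hwκ hI hmono hF hC hf hΛI (by lia) (hcover _ (by lia))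
      (hKΛ _) (hK _) _ _ (h𝓑.isOpen z.2.2.2.2.2)
      (TopologicalSpace.nonempty_of_mem_countableBasis z.2.2.2.2.2)
  obtain ⟨u, hu0, hu⟩ := hdense.inter_open_nonempty _ isOpen_compl_singleton
    (dense_compl_singleton (0 : Fin d → X)).nonempty
  refine ⟨polySubalgebra coord u, ⟨u, self_mem_polySubalgebra coord u, hu0⟩, fun y hy hy0 => ?_⟩
  obtain ⟨b, m, M, a, hb, hm, rfl⟩ := exists_eq_smul_polyVec hR.coord_injective hy hy0
  intro lam hlam
  obtain ⟨r, hr⟩ := mem_iUnion.1 hlam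
  obtain ⟨s, hs⟩ := exists_nat_ge ‖a‖
  obtain ⟨m, rfl⟩ := Nat.exists_eq_add_of_le' hm
  refine IsHypercyclicVector.smul ?_ hb
  refine h𝓑.dense_iff.2 fun V hV hVne => ?_
  obtain ⟨n, hn, h⟩ := mem_iInter.1 hu (r, m, M, s, ⟨V, hV⟩) (lam, a)
    ⟨hr, mem_closedBall_zero_iff.2 hs⟩
  exact ⟨_, h, n, hn, rfl⟩

end Baire

/-! ### The equivalence -/

/-- The weights of a family satisfying the hypotheses on the sums of their logarithms form a shift
family: `log w_n = f_n - f_{n-1}` is a Lipschitz function of the parameter. -/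
theorem isShiftFamily_of_logSum {X : Type*} [NonUnitalCommRing X] [Module ℂ X] [TopologicalSpace X]
    {coord : X →ₙₐ[ℂ] (ℕ → ℂ)} {I : Set ℝ} {w : ℕ → ℝ → ℝ} {B : ℝ → X →L[ℂ] X} {κ c C : ℝ}
    {F : ℕ → ℝ} (hB : ∀ a ∈ I, IsWeightedShift coord (fun n => w n a) (B a)) (hκ : 0 < κ)
    (hwκ : ∀ n, 1 ≤ n → ∀ a ∈ I, κ ≤ w n a) (hc : 0 < c)
    (hf : ∀ n, 1 ≤ n → ∀ a ∈ I, ∀ b ∈ I, |logSum w n a - logSum w n b| ≤ C * F n * |b - a|)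
    (hw_ratio : ∀ n, 1 ≤ n → ∀ a ∈ I, ∀ b ∈ I, c ≤ w n a / w n b) :
    IsShiftFamily coord I w B c := by
  have hpos : ∀ a ∈ I, ∀ n, 1 ≤ n → 0 < w n a := fun a ha n hn => hκ.trans_le (hwκ n hn a ha)
  have hcont : ∀ n, ContinuousOn (logSum w n) I := by
    rintro (_ | n)
    · have : logSum w 0 = fun _ => 0 := by ext a; simp [logSum]
      rw [this]
      exact continuousOn_const
    · intro b hb
      rw [ContinuousWithinAt, tendsto_iff_dist_tendsto_zero]
      have hlim : Tendsto (fun a => C * F (n + 1) * |b - a|) (𝓝[I] b) (𝓝 0) := by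
        have : Continuous fun a => C * F (n + 1) * |b - a| := by fun_prop
        simpa using (this.tendsto b).mono_left nhdsWithin_le_nhds
      refine tendsto_of_tendsto_of_tendsto_of_le_of_le' tendsto_const_nhds hlim
        (Eventually.of_forall fun _ => dist_nonneg) ?_
      filter_upwards [self_mem_nhdsWithin] with a ha
      exact hf (n + 1) (by lia) a ha b hb
  refine ⟨fun a ha x n => hB a ha x n, hpos, fun n hn => ?_, hc, fun n hn a ha b hb =>
    (le_div_iff₀ (hpos b hb n hn)).1 (hw_ratio n hn a ha b hb)⟩
  obtain ⟨n, rfl⟩ := Nat.exists_eq_add_of_le' hn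
  refine (Real.continuous_exp.comp_continuousOn ((hcont (n + 1)).sub (hcont n))).congr
    fun a ha => ?_
  simp only [Function.comp_apply, Pi.sub_apply, logSum]
  rw [Finset.sum_Icc_succ_top (by lia), add_sub_cancel_left, Real.exp_log (hpos a ha _ hn)]

end CommonHypercyclic

theorem mainTheorem3 {X : Type*} [NonUnitalCommRing X] [Module ℂ X]
    [UniformSpace X] [IsUniformAddGroup X]
    -- the space of sequences, its seminorms and its canonical vectors
    (coord : X →ₙₐ[ℂ] (ℕ → ℂ)) (p : ℕ → Seminorm ℂ X) (e : ℕ → X)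
    (hX : CommonHypercyclic.IsFrechetSequenceAlgebra coord p)
    (hnorm : CommonHypercyclic.HasContinuousNorm X)
    (he : ∀ n, coord (e n) = Pi.single n 1)
    (hbasis : CommonHypercyclic.IsUnconditionalBasis e)
    -- the parameters
    (I : Set ℝ) (hI : I.OrdConnected) (hI_ne : I.Nonempty)
    (d : ℕ) (hd : 1 ≤ d)
    (Λ : Set (Fin d → ℝ)) (hΛI : ∀ lam ∈ Λ, ∀ i, lam i ∈ I) (hΛ : IsSigmaCompact Λ)
    -- the weighted shifts
    (w : ℕ → ℝ → ℝ) (B : ℝ → X →L[ℂ] X)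
    (hB : ∀ a ∈ I, CommonHypercyclic.IsWeightedShift coord (fun n => w n a) (B a))
    (hw_mono : ∀ n, 1 ≤ n → MonotoneOn (w n) I)
    (hw_inf : ∃ κ : ℝ, 0 < κ ∧ ∀ n, 1 ≤ n → ∀ a ∈ I, κ ≤ w n a)
    -- the two-sided bound and the bound on quotients
    (F : ℕ → ℝ) (hF_nonneg : ∀ n, 0 ≤ F n) (hF_mono : Monotone F)
    (c C : ℝ) (hc : 0 < c) (hC : 0 < C)
    (hf : ∀ n, 1 ≤ n → ∀ a ∈ I, ∀ b ∈ I,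
      c * F n * |a - b| ≤ |CommonHypercyclic.logSum w n a - CommonHypercyclic.logSum w n b| ∧
      |CommonHypercyclic.logSum w n a - CommonHypercyclic.logSum w n b| ≤ C * F n * |b - a|)
    (hw_ratio : ∀ n, 1 ≤ n → ∀ a ∈ I, ∀ b ∈ I, c ≤ w n a / w n b) :
    List.TFAE [
      -- (a)
      CommonHypercyclic.HasCommonHypercyclicAlgebra
        (CommonHypercyclic.prodOp (d := d) B) Λ,
      -- (b)
      ∀ m : ℕ, 1 ≤ m → ∃ u : Fin d → X,
        CommonHypercyclic.IsCommonHypercyclicVector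
          (CommonHypercyclic.prodOp (d := d) B) Λ (CommonHypercyclic.algPow u m),
      -- (c)
      ∀ m : ℕ, 1 ≤ m → ∀ τ : ℝ, 0 < τ → ∀ N : ℕ, 1 ≤ N → ∀ ε : ℝ, 0 < ε →
        ∀ K : Set (Fin d → ℝ), K ⊆ Λ → IsCompact K →
        ∃ (q : ℕ) (n : ℕ → ℕ) (lam : ℕ → Fin d → ℝ),
          (1 ≤ q → N ≤ n 1) ∧
          (∀ k, 1 ≤ k → k < q → n k + N ≤ n (k + 1)) ∧
          (∀ k ∈ Finset.Icc 1 q, ∀ i, lam k i ∈ I) ∧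
          -- (i)
          (K ⊆ ⋃ k ∈ Finset.Icc 1 q,
            Set.pi Set.univ fun l => CommonHypercyclic.tagInterval τ (F (n k)) (lam k l)) ∧
          -- (ii)
          (∀ i : Fin d,
            CommonHypercyclic.fNorm p
              (∑ k ∈ Finset.Icc 1 q,
                ((1 / CommonHypercyclic.weightProd w (lam k i) 1 (n k) ^ (1 / (m : ℝ)) : ℝ) : ℂ)
                  • e (n k)) < ε) ∧
          -- (iii)
          (∀ k ∈ Finset.Icc 1 q, ∀ i : Fin d, ∀ l : ℕ, l ≤ N →
            CommonHypercyclic.fNorm p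
              (∑ j ∈ Finset.Icc (k + 1) q,
                ((CommonHypercyclic.weightProd w (lam k i) (n j - n k + l + 1) (n j + l) /
                  CommonHypercyclic.weightProd w (lam j i) (l + 1) (n j + l) : ℝ) : ℂ)
                  • e (n j - n k + l)) < ε)] := by
  obtain ⟨R, hR⟩ := hX.exists_solidSystem hnorm he hbasis
  obtain ⟨κ, hκ, hwκ⟩ := hw_inf
  have hS := CommonHypercyclic.isShiftFamily_of_logSum hB hκ hwκ hc
    (fun n hn a ha b hb => (hf n hn a ha b hb).2) hw_ratio
  have := hX.continuousSMul
  have := hX.continuousMul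
  have := hX.t2Space
  have := hX.complete
  have := hX.uniformity_isCountablyGenerated
  tfae_have 1 → 2 := fun h m hm => h.exists_algPow hX.coord_injective hm
  tfae_have 2 → 3 := by
    intro h m hm τ hτ N hN ε hε
    obtain ⟨u, hu⟩ := h m hm
    exact CommonHypercyclic.coverCondition_of_isCommonHypercyclicVector_algPow hS hR hI_ne hd hΛI hc
      (fun n hn a ha b hb => (hf n hn a ha b hb).1) hm hu τ hτ N hN _ (hX.fNorm_lt_mem_nhds hε)
  tfae_have 3 → 1 := by
    intro h
    refine CommonHypercyclic.hasCommonHypercyclicAlgebra_of_coverCondition hS hR hκ hwκ hI_ne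
      hw_mono hF_mono hC (fun n hn a ha b hb => (hf n hn a ha b hb).2) hd hΛI hΛ
      fun m hm τ hτ N hN U hU K hKΛ hK => ?_
    obtain ⟨ε, hε, hεU⟩ := hX.exists_fNorm_lt_imp_mem hU
    obtain ⟨q, n, lam, h1, h2, h3, h4, h5, h6⟩ := h m hm τ hτ N hN ε hε K hKΛ hK
    exact ⟨q, n, lam, h1, h2, h3, h4, fun i => hεU _ (h5 i), fun k hk i l hl =>
      hεU _ (h6 k hk i l hl)⟩
  tfae_finish
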